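/- Let $k$ be a commutative domain in which $2$ is invertible, and let $k^\times$ be its group of units. For $n\ge 1$ let $W_n$ be the $k$-algebra generated by $x_1,\dots,x_n$ subject to the relations $x_ix_j+x_jx_i=1$ for all $i\ne j$, and let $k[x_1^2,\dots,x_n^2]$ be the subalgebra of $W_n$ generated by the squares $x_i^2$. For a $k$-algebra $A$ let $A[t]$ be the polynomial extension and $A[\underline t_m^{\pm1}]=A[t_1^{\pm1},\dots,t_m^{\pm1}]$ the Laurent polynomial extension in central variables; $\mathrm{Aut}$ denotes the group of $k$-algebra automorphisms, under composition. The group $S_n\times\{\pm1\}$ acts on $W_n$ by $(\sigma,\varepsilon)\colon x_i\mapsto \varepsilon x_{\sigma(i)}$. For an abelian group $U$, $S_2\ltimes U$ is the semidirect product in which the transposition inverts $U$. The group $S_2\ltimes k^\times$ acts on $W_2$: $S_2$ permutes $x_1,x_2$, and $u\in k^\times$ acts by $x_1\mapsto ux_1$, $x_2\mapsto u^{-1}x_2$; $S_2\ltimes k[\underline t_m^{\pm1}]^\times$ acts on $W_2[\underline t_m^{\pm1}]$ by the same formulas, fixing every $t_j$. The group $(k^\times)^m\rtimes GL_m(\mathbb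 Z)$ acts on $k[\underline t_m^{\pm1}]$ and, fixing every $x_i$, on $W_n[\underline t_m^{\pm1}]$: $M\in GL_m(\mathbb Z)$ acts by $t_j\mapsto\prod_i t_i^{M_{ij}}$ and $c\in(k^\times)^m$ by $t_j\mapsto c_jt_j$. If a group $G$ acts on $W_n$ by $k$-algebra automorphisms preserving $R=k[x_1^2,\dots,x_n^2]$, then $\begin{pmatrix}G&R\\0&k^\times\end{pmatrix}$ is the group of triples $(g,r,c)\in G\times R\times k^\times$ with product $(g,r,c)(g',r',c')=(gg',\,g(r')+c'r,\,cc')$; $(g,r,c)$ acts on $W_n[t]$ by $x\mapsto g(x)$ for $x\in W_n$ and $t\mapsto ct+r$. Let $n$ be a positive even integer and $m$ a positive integer. The actions just described give group isomorphisms as follows. 1. $\mathrm{Aut}(W_2[t])=\begin{pmatrix}S_2\ltimes k^\times & k[x_1^2,x_2^2]\\ 0&k^\times\end{pmatrix}$. 2. $\mathrm{Aut}(W_2[\underline t_m^{\pm1}])=\left(S_2\ltimes k[\underline t_m^{\pm1}]^\times\right)\rtimes\left((k^\times)^m\rtimes GL_m(\mathbb Z)\right)$, where $(k^\times)^m\rtimes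 GL_m(\mathbb Z)$ acts on $k[\underline t_m^{\pm1}]^\times$ through its action on $k[\underline t_m^{\pm1}]$, and trivially on $S_2$. 3. If $n\ge4$, then $\mathrm{Aut}(W_n[t])=\begin{pmatrix}S_n\times\{\pm1\} & k[x_1^2,\dots,x_n^2]\\ 0&k^\times\end{pmatrix}$. 4. If $n\ge4$, then $\mathrm{Aut}(W_n[\underline t_m^{\pm1}])=\left(S_n\times\{\pm1\}\right)\times\left((k^\times)^m\rtimes GL_m(\mathbb Z)\right)$. 5. If $\mathbb Q\subseteq k$, then every locally nilpotent derivation of $W_n$ is zero, that is, every $k$-linear map $\partial\colon W_n\to W_n$ with $\partial(ab)=\partial(a)b+a\,\partial(b)$ for all $a,b$, and such that for every $a$ some power of $\partial$ kills $a$, is zero. -/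

import Mathlib

open Polynomial

/-! ### The algebra `W_n` -/

/-- The relations `x_i x_j + x_j x_i = 1` (for `i ≠ j`) on the free algebra. -/
inductive WRel (k : Type*) [CommRing k] (n : ℕ) :
    FreeAlgebra k (Fin n) → FreeAlgebra k (Fin n) → Prop
  | anticomm (i j : Fin n) (h : i ≠ j) :
      WRel k n (FreeAlgebra.ι k i * FreeAlgebra.ι k j
        + FreeAlgebra.ι k j * FreeAlgebra.ι k i) 1

/-- `W_n`: the `k`-algebra generated by `x_1, …, x_n` subject to `x_i x_j + x_j x_i = 1`
for all `i ≠ j`. -/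
abbrev WAlg (k : Type*) [CommRing k] (n : ℕ) : Type _ := RingQuot (WRel k n)

namespace WAlg

noncomputable section

/-- The generator `x_i` of `W_n`. -/
def x (k : Type*) [CommRing k] {n : ℕ} (i : Fin n) : WAlg k n :=
  RingQuot.mkAlgHom k (WRel k n) (FreeAlgebra.ι k i)

theorem x_mul_x (k : Type*) [CommRing k] {n : ℕ} {i j : Fin n} (h : i ≠ j) :
    x k i * x k j + x k j * x k i = 1 := by
  have := RingQuot.mkAlgHom_rel k (WRel.anticomm (k := k) i j h)
  simpa [x] using this

theorem hom_ext {k : Type*} [CommRing k] {n : ℕ} {B : Type*} [Ring B] [Algebra k B]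
    {f g : WAlg k n →ₐ[k] B} (h : ∀ i, f (x k i) = g (x k i)) : f = g := by
  apply RingQuot.ringQuot_ext'
  apply FreeAlgebra.hom_ext
  funext i
  exact h i

/-- The subalgebra `k[x_1^2, …, x_n^2]` of `W_n`. -/
def squares (k : Type*) [CommRing k] (n : ℕ) : Subalgebra k (WAlg k n) :=
  Algebra.adjoin k (Set.range fun i : Fin n => x k i ^ 2)

/-- The endomorphism `x_i ↦ c_{σ(i)} x_{σ(i)}` of `W_n`, where `c_i c_j = 1` for `i ≠ j`. -/
def monomialHom {k : Type*} [CommRing k] {n : ℕ} (σ : Equiv.Perm (Fin n)) (c : Fin n → k)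
    (hc : ∀ i j, i ≠ j → c i * c j = 1) : WAlg k n →ₐ[k] WAlg k n :=
  RingQuot.liftAlgHom k ⟨FreeAlgebra.lift k fun i => c (σ i) • x k (σ i), by
    rintro _ _ ⟨i, j, h⟩
    have h' : σ i ≠ σ j := fun e => h (σ.injective e)
    simp only [map_add, map_mul, map_one, FreeAlgebra.lift_ι_apply, smul_mul_smul_comm]
    rw [hc _ _ h', hc _ _ h'.symm, one_smul, one_smul, x_mul_x k h']⟩

@[simp] theorem monomialHom_x {k : Type*} [CommRing k] {n : ℕ} (σ : Equiv.Perm (Fin n))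
    (c : Fin n → k) (hc : ∀ i j, i ≠ j → c i * c j = 1) (i : Fin n) :
    monomialHom σ c hc (x k i) = c (σ i) • x k (σ i) := by
  simp [monomialHom, x]

theorem monomialHom_mem_squares {k : Type*} [CommRing k] {n : ℕ} (σ : Equiv.Perm (Fin n))
    (c : Fin n → k) (hc : ∀ i j, i ≠ j → c i * c j = 1) (a : WAlg k n)
    (ha : a ∈ squares k n) : monomialHom σ c hc a ∈ squares k n := by
  have h : squares k n ≤ (squares k n).comap (monomialHom σ c hc) := by
    refine Algebra.adjoin_le ?_
    rintro _ ⟨i, rfl⟩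
    change monomialHom σ c hc (x k i ^ 2) ∈ squares k n
    rw [map_pow, monomialHom_x, _root_.smul_pow]
    exact Subalgebra.smul_mem _ (Algebra.subset_adjoin (Set.mem_range_self (σ i))) _
  exact h ha

/-! ### The group `S_n × {±1}` acting on `W_n` -/

/-- `(σ, ε)` acts on `W_n` by `x_i ↦ ε x_{σ(i)}`. -/
def signedPerm (k : Type*) [CommRing k] (n : ℕ) :
    Equiv.Perm (Fin n) × ℤˣ →* (WAlg k n →ₐ[k] WAlg k n) where
  toFun g := monomialHom g.1 (fun _ => ((g.2 : ℤ) : k)) (by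
    intro i j _
    rw [← Int.cast_mul, Int.units_coe_mul_self, Int.cast_one])
  map_one' := hom_ext fun i => by simp
  map_mul' g h := hom_ext fun i => by
    simp [smul_smul, mul_comm]

end

end WAlg

/-! ### The group `S_2 ⋉ U` for an abelian group `U` -/

/-- The action of `S_2` on an abelian group `U` through which the transposition acts by
inversion: `σ` acts by `u ↦ u ^ sign σ`. -/
def signAct (U : Type*) [CommGroup U] : Equiv.Perm (Fin 2) →* MulAut U where
  toFun σ :=
    { toFun := fun u => u ^ ((Equiv.Perm.sign σ : ℤˣ) : ℤ)
      invFun := fun u => u ^ ((Equiv.Perm.sign σ : ℤˣ) : ℤ)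
      left_inv := fun u => by
        dsimp only
        rw [← zpow_mul, Int.units_coe_mul_self, zpow_one]
      right_inv := fun u => by
        dsimp only
        rw [← zpow_mul, Int.units_coe_mul_self, zpow_one]
      map_mul' := fun u v => mul_zpow u v _ }
  map_one' := by ext u; simp
  map_mul' σ τ := by
    ext u
    simp only [map_mul, Units.val_mul, MulAut.mul_apply, MulEquiv.coe_mk, Equiv.coe_fn_mk]
    rw [← zpow_mul, mul_comm]

/-- `S_2 ⋉ U`, the transposition inverting the elements of `U`. -/
abbrev SwapTorus (U : Type*) [CommGroup U] : Type _ := U ⋊[signAct U] Equiv.Perm (Fin 2)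

/-- The weights `(u, u⁻¹)` with which `u` acts on `(x_1, x_2)`. -/
def torusWeight {U : Type*} [CommGroup U] (u : U) (i : Fin 2) : U := if i = 0 then u else u⁻¹

theorem torusWeight_mul_eq_one {U : Type*} [CommGroup U] (u : U) {i j : Fin 2} (h : i ≠ j) :
    torusWeight u i * torusWeight u j = 1 := by
  fin_cases i <;> fin_cases j <;> simp_all [torusWeight]

theorem torusWeight_signAct {U : Type*} [CommGroup U] (u v : U) (σ : Equiv.Perm (Fin 2))
    (i : Fin 2) :
    torusWeight (u * signAct U σ v) (σ i) = torusWeight u (σ i) * torusWeight v i := by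
  have hσ : σ = 1 ∨ σ = Equiv.swap 0 1 := by
    revert σ; decide
  rcases hσ with rfl | rfl
  · fin_cases i <;> simp [torusWeight, mul_comm]
  · fin_cases i <;> simp [torusWeight, signAct, mul_comm]

namespace WAlg

/-- `(u, σ) ∈ S_2 ⋉ k^×` acts on `W_2` by permuting the generators by `σ` and then rescaling
`(x_1, x_2)` to `(u x_1, u⁻¹ x_2)`. -/
noncomputable def swapTorus (k : Type*) [CommRing k] :
    SwapTorus kˣ →* (WAlg k 2 →ₐ[k] WAlg k 2) where
  toFun g := monomialHom g.right (fun i => ((torusWeight g.left i : kˣ) : k)) (by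
    intro i j h
    rw [← Units.val_mul, torusWeight_mul_eq_one _ h, Units.val_one])
  map_one' := hom_ext fun i => by simp [torusWeight]
  map_mul' g h := hom_ext fun i => by
    simp only [monomialHom_x, AlgHom.mul_apply, map_smul, SemidirectProduct.mul_right,
      SemidirectProduct.mul_left, Equiv.Perm.mul_apply, smul_smul]
    rw [torusWeight_signAct, Units.val_mul, mul_comm]

/-- The restriction to `k[x_1^2, …, x_n^2]` of a group action on `W_n` preserving it. -/
noncomputable def restrictSquares {k : Type*} [CommRing k] {n : ℕ} {G : Type*} [Group G]
    (ρ : G →* (WAlg k n →ₐ[k] WAlg k n))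
    (hρ : ∀ g, ∀ a ∈ squares k n, ρ g a ∈ squares k n) :
    Representation k G (squares k n) where
  toFun g := ((ρ g).toLinearMap).restrict (p := Subalgebra.toSubmodule (squares k n))
    (q := Subalgebra.toSubmodule (squares k n)) (hρ g)
  map_one' := by ext a; simp [LinearMap.restrict_apply]
  map_mul' g h := by
    ext a
    change ρ (g * h) a = ρ g (ρ h a)
    rw [map_mul, AlgHom.mul_apply]

/-- `S_n × {±1}` acting on `k[x_1^2, …, x_n^2]`. -/
noncomputable def signedPermSquares (k : Type*) [CommRing k] (n : ℕ) :
    Representation k (Equiv.Perm (Fin n) × ℤˣ) (squares k n) :=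
  restrictSquares (signedPerm k n) fun _ _ ha => monomialHom_mem_squares _ _ _ _ ha

/-- `S_2 ⋉ k^×` acting on `k[x_1^2, x_2^2]`. -/
noncomputable def swapTorusSquares (k : Type*) [CommRing k] :
    Representation k (SwapTorus kˣ) (squares k 2) :=
  restrictSquares (swapTorus k) fun _ _ ha => monomialHom_mem_squares _ _ _ _ ha

end WAlg

/-! ### Triangular groups -/

/-- The triangular matrices `(g r; 0 c)` with `g ∈ G`, `r ∈ M` and `c ∈ k^×`, where the group
`G` acts `k`-linearly on `M` through `ρ`. -/
@[ext] structure TriMat {k G M : Type*} [CommRing k] [Group G] [AddCommGroup M] [Module k M]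
    (ρ : Representation k G M) where
  /-- the upper left entry -/
  diag : G
  /-- the upper right entry -/
  entry : M
  /-- the lower right entry -/
  scal : kˣ

namespace TriMat

variable {k G M : Type*} [CommRing k] [Group G] [AddCommGroup M] [Module k M]
  {ρ : Representation k G M}

/-- Matrix multiplication: `(g r; 0 c) (g' r'; 0 c') = (g g', g·r' + c' r; 0, c c')`. -/
instance : Mul (TriMat ρ) :=
  ⟨fun p q => ⟨p.diag * q.diag, ρ p.diag q.entry + (q.scal : k) • p.entry, p.scal * q.scal⟩⟩

instance : One (TriMat ρ) := ⟨⟨1, 0, 1⟩⟩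

instance : Inv (TriMat ρ) :=
  ⟨fun p => ⟨p.diag⁻¹, -(((p.scal⁻¹ : kˣ) : k) • ρ p.diag⁻¹ p.entry), p.scal⁻¹⟩⟩

theorem mul_def (p q : TriMat ρ) : p * q =
    ⟨p.diag * q.diag, ρ p.diag q.entry + (q.scal : k) • p.entry, p.scal * q.scal⟩ := rfl

theorem one_def : (1 : TriMat ρ) = ⟨1, 0, 1⟩ := rfl

theorem inv_def (p : TriMat ρ) :
    p⁻¹ = ⟨p.diag⁻¹, -(((p.scal⁻¹ : kˣ) : k) • ρ p.diag⁻¹ p.entry), p.scal⁻¹⟩ := rfl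

instance : Group (TriMat ρ) :=
  Group.ofLeftAxioms
    (fun p q r => by
      simp only [mul_def, TriMat.mk.injEq, map_mul, map_add, map_smul, Module.End.mul_apply,
        smul_add, smul_smul, Units.val_mul, mul_assoc, add_assoc, true_and, and_true]
      rw [mul_comm (r.scal : k)])
    (fun p => by simp [mul_def, one_def])
    (fun p => by
      simp [mul_def, one_def, inv_def, smul_smul])

end TriMat

/-- The triangular group with diagonal `S_2 ⋉ k^×`, `k^×` and upper right entries in
`k[x_1^2, x_2^2]`. -/
abbrev TriSwapTorus (k : Type*) [CommRing k] : Type _ :=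
  TriMat (k := k) (G := SwapTorus kˣ) (M := WAlg.squares k 2) (WAlg.swapTorusSquares k)

/-- The triangular group with diagonal `S_n × {±1}`, `k^×` and upper right entries in
`k[x_1^2, …, x_n^2]`. -/
abbrev TriSignedPerm (k : Type*) [CommRing k] (n : ℕ) : Type _ :=
  TriMat (k := k) (G := Equiv.Perm (Fin n) × ℤˣ) (M := WAlg.squares k n)
    (WAlg.signedPermSquares k n)

/-! ### Laurent polynomial extensions -/

/-- The Laurent polynomial extension `A[t_1^{±1}, …, t_m^{±1}]` with central variables: the
algebra of `ℤ^m` over `A`. The monomial `a t^v` is `AddMonoidAlgebra.single v a`. -/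
abbrev Laurent (A : Type*) [Ring A] (m : ℕ) : Type _ := AddMonoidAlgebra A (Fin m → ℤ)

namespace Laurent

noncomputable section

/-- The monomial `c^v = ∏ c_i ^ v_i`. -/
def monom {U : Type*} [CommGroup U] {m : ℕ} (c : Fin m → U) (v : Fin m → ℤ) : U :=
  ∏ i, c i ^ v i

theorem monom_add {U : Type*} [CommGroup U] {m : ℕ} (c : Fin m → U) (v w : Fin m → ℤ) :
    monom c (v + w) = monom c v * monom c w := by
  simp [monom, zpow_add, Finset.prod_mul_distrib]

theorem monom_mul {U : Type*} [CommGroup U] {m : ℕ} (c d : Fin m → U) (v : Fin m → ℤ) :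
    monom (c * d) v = monom c v * monom d v := by
  simp [monom, mul_zpow, Finset.prod_mul_distrib]

/-- The tuple `c^M`, whose `j`-th entry is `∏ i, c_i ^ M_{ij}`. -/
def powMatrix {U : Type*} [CommGroup U] {m : ℕ} (c : Fin m → U)
    (M : Matrix (Fin m) (Fin m) ℤ) : Fin m → U := fun j => ∏ i, c i ^ M i j

theorem powMatrix_one {U : Type*} [CommGroup U] {m : ℕ} (c : Fin m → U) :
    powMatrix c 1 = c := by
  funext j
  simp only [powMatrix]
  rw [Finset.prod_eq_single j]
  · simp
  · intro i _ h; simp [Matrix.one_apply_ne h]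
  · simp

theorem monom_powMatrix {U : Type*} [CommGroup U] {m : ℕ} (c : Fin m → U)
    (M : Matrix (Fin m) (Fin m) ℤ) (v : Fin m → ℤ) :
    monom (powMatrix c M) v = monom c (M.mulVec v) := by
  simp only [monom, powMatrix, Matrix.mulVec, dotProduct]
  simp only [← Finset.prod_zpow]
  rw [Finset.prod_comm]
  refine Finset.prod_congr rfl fun i _ => ?_
  simp only [← zpow_mul]
  exact (map_sum (zmultiplesHom (Additive U) (Additive.ofMul (c i))) _ Finset.univ).symm

theorem powMatrix_mul {U : Type*} [CommGroup U] {m : ℕ} (c : Fin m → U)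
    (M N : Matrix (Fin m) (Fin m) ℤ) : powMatrix c (M * N) = powMatrix (powMatrix c M) N := by
  funext j
  exact (monom_powMatrix c M fun i => N i j).symm

/-- The action of `GL_m(ℤ)` on `U^m` in which `M` sends `c` to `c^(M⁻¹)`. -/
def glAct (U : Type*) [CommGroup U] (m : ℕ) :
    Matrix.GeneralLinearGroup (Fin m) ℤ →* MulAut (Fin m → U) where
  toFun M :=
    { toFun := fun c => powMatrix c (M⁻¹ : Matrix.GeneralLinearGroup (Fin m) ℤ).val
      invFun := fun c => powMatrix c M.val
      left_inv := fun c => by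
        dsimp only
        rw [← powMatrix_mul, ← Units.val_mul, inv_mul_cancel, Units.val_one, powMatrix_one]
      right_inv := fun c => by
        dsimp only
        rw [← powMatrix_mul, ← Units.val_mul, mul_inv_cancel, Units.val_one, powMatrix_one]
      map_mul' := fun c d => funext fun _ => monom_mul c d _ }
  map_one' := by
    ext c : 1
    simp [powMatrix_one]
  map_mul' M N := by
    ext c : 1
    simp [powMatrix_mul]

theorem monom_glAct {U : Type*} [CommGroup U] {m : ℕ}
    (M : Matrix.GeneralLinearGroup (Fin m) ℤ) (c : Fin m → U) (v : Fin m → ℤ) :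
    monom (glAct U m M c) v = monom c ((M⁻¹).val.mulVec v) :=
  monom_powMatrix c _ v

/-- `U^m ⋊ GL_m(ℤ)`. -/
abbrev TorusGL (U : Type*) [CommGroup U] (m : ℕ) : Type _ :=
  (Fin m → U) ⋊[glAct U m] Matrix.GeneralLinearGroup (Fin m) ℤ

/-- `(c, M) ∈ (k^×)^m ⋊ GL_m(ℤ)` acts on `k[t_1^{±1}, …, t_m^{±1}]` by the algebra map with
`t^v ↦ c^(M v) t^(M v)`; in particular `t_j ↦ ∏ i, (c_i t_i) ^ M_{ij}`. -/
def torusGLHom (k : Type*) [CommRing k] (m : ℕ) :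
    TorusGL kˣ m →* (Laurent k m →ₐ[k] Laurent k m) where
  toFun g := AddMonoidAlgebra.lift k (Laurent k m) (Fin m → ℤ)
    { toFun := fun v => AddMonoidAlgebra.single (g.right.val.mulVec v.toAdd)
        ((monom g.left (g.right.val.mulVec v.toAdd) : kˣ) : k)
      map_one' := by
        simp [monom, AddMonoidAlgebra.one_def]
      map_mul' := fun v w => by
        simp [Matrix.mulVec_add, monom_add, AddMonoidAlgebra.single_mul_single] }
  map_one' := by
    apply AddMonoidAlgebra.algHom_ext
    intro v
    · simp [monom]
    · exact Subsingleton.elim _ _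
  map_mul' g h := by
    apply AddMonoidAlgebra.algHom_ext
    intro v
    · simp only [AlgHom.mul_apply, AddMonoidAlgebra.lift_single, one_smul, MonoidHom.coe_mk,
        OneHom.coe_mk, toAdd_ofAdd, SemidirectProduct.mul_left, SemidirectProduct.mul_right,
        AddMonoidAlgebra.smul_single, smul_eq_mul, monom_mul, monom_glAct, Units.val_mul,
        Matrix.mulVec_mulVec]
      rw [← Units.val_mul g.right, ← Units.val_mul g.right⁻¹, inv_mul_cancel_left, mul_comm]
    · exact Subsingleton.elim _ _

@[simp] theorem torusGLHom_single (k : Type*) [CommRing k] (m : ℕ) (g : TorusGL kˣ m)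
    (v : Fin m → ℤ) (a : k) :
    torusGLHom k m g (AddMonoidAlgebra.single v a) =
      AddMonoidAlgebra.single (g.right.val.mulVec v)
        (a * (monom g.left (g.right.val.mulVec v) : kˣ)) := by
  simp [torusGLHom]

/-- The induced action of `(k^×)^m ⋊ GL_m(ℤ)` on the group of units of
`k[t_1^{±1}, …, t_m^{±1}]`. -/
def torusGLUnits (k : Type*) [CommRing k] (m : ℕ) :
    TorusGL kˣ m →* MulAut (Laurent k m)ˣ where
  toFun g := MonoidHom.toMulEquiv (Units.map (torusGLHom k m g : Laurent k m →* Laurent k m))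
    (Units.map (torusGLHom k m g⁻¹ : Laurent k m →* Laurent k m))
    (by
      ext u : 2
      change torusGLHom k m g⁻¹ (torusGLHom k m g u) = u
      rw [← AlgHom.mul_apply, ← map_mul, inv_mul_cancel, map_one, AlgHom.one_apply])
    (by
      ext u : 2
      change torusGLHom k m g (torusGLHom k m g⁻¹ u) = u
      rw [← AlgHom.mul_apply, ← map_mul, mul_inv_cancel, map_one, AlgHom.one_apply])
  map_one' := by
    ext u : 2
    change torusGLHom k m 1 u = u
    rw [map_one, AlgHom.one_apply]
  map_mul' g h := by
    ext u : 2
    change torusGLHom k m (g * h) u = torusGLHom k m g (torusGLHom k m h u)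
    rw [map_mul, AlgHom.mul_apply]

/-- The action of `(k^×)^m ⋊ GL_m(ℤ)` on `S_2 ⋉ (k[t_1^{±1}, …, t_m^{±1}])^×` that is the
induced action on the units and is trivial on `S_2`. -/
def torusGLSwap (k : Type*) [CommRing k] (m : ℕ) :
    TorusGL kˣ m →* MulAut (SwapTorus (Laurent k m)ˣ) where
  toFun g := SemidirectProduct.congr (torusGLUnits k m g) (MulEquiv.refl _) (by
    intro σ
    ext u : 1
    simp [signAct])
  map_one' := by
    ext q : 1
    apply SemidirectProduct.ext <;> simp
  map_mul' g h := by
    ext q : 1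
    apply SemidirectProduct.ext <;> simp

/-- The inclusion `k[t_1^{±1}, …, t_m^{±1}] → A[t_1^{±1}, …, t_m^{±1}]`. -/
def coeffs (k A : Type*) [CommRing k] [Ring A] [Algebra k A] (m : ℕ) :
    Laurent k m →ₐ[k] Laurent A m :=
  AddMonoidAlgebra.mapAlgHom (Fin m → ℤ) (Algebra.ofId k A)

/-- An element of `A`, viewed as a constant Laurent polynomial. -/
def const {A : Type*} [Ring A] (m : ℕ) (a : A) : Laurent A m := AddMonoidAlgebra.single 0 a

/-- The variable `t_j` of `A[t_1^{±1}, …, t_m^{±1}]`. -/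
def t (A : Type*) [Ring A] {m : ℕ} (j : Fin m) : Laurent A m :=
  AddMonoidAlgebra.single (Pi.single j 1) 1

end

end Laurent

/-! ### Locally nilpotent derivations -/

/-- `D` is a derivation of the (not necessarily commutative) `k`-algebra `A`. -/
def IsDerivation {k A : Type*} [CommRing k] [Ring A] [Algebra k A] (D : A →ₗ[k] A) : Prop :=
  ∀ a b : A, D (a * b) = D a * b + a * D b

/-- Every element is killed by some power of `D`. -/
def IsLocallyNilpotent {k A : Type*} [CommRing k] [Ring A] [Algebra k A] (D : A →ₗ[k] A) : Prop :=
  ∀ a : A, ∃ N : ℕ, (D ^ N) a = 0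

/-! Monomials, one for each exponent vector, form a basis of `W_n`: reordering a word costs a sign
and shorter words, and independence is read off from an action on the free module on monomials
(`fockHom`). Leading forms therefore multiply like commutative monomials up to sign, so the total
degree is additive (`deg_mul`), `W_n` is a domain and its units are those of `k`. Comparing powers
of `X` first gives an additive degree on `W_n[X]`. Each `x_i ^ 2` is central, so every element is a
sum `∑ r_S x_S` over subsets `S`, with `r_S` in the algebra of squares.

The heart is an absence of cancellation (`IsDegree.le_sum_central_mul_prod`). Let `g_1, …, g_n`
anticommute up to lower degree. Moving `g_i` past `g_S` produces the sign `(-1)^|S \ {i}|`, and for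
even `n` these sign patterns distinguish the subsets. Anticommuting with `g_i` selects the terms of
one sign, so no term of `∑ r_S g_S` with central `r_S` has larger degree than the sum. In particular
the centre of `W_n` is the algebra of squares (`mem_squares_of_central`).

For an automorphism `φ` of `W_n[X]` put `g_i = φ(x_i)`; it is not a scalar, so its degree is at
least that of `x_i`. Applying `φ` to the expansion of `φ⁻¹(x_i)` gives `x_i = ∑ φ(r_S) g_S`. Every
term has degree at most that of `x_i`, hence `|S| ≤ 1` and the coefficients are scalars: `φ⁻¹(x_i)`
is an affine combination of generators (`symm_map_C_x`). The relations then force `x_i ↦ c_{σ(i)}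
x_{σ(i)}` with `c_i c_j = 1` for `i ≠ j` (`exists_monomial_of_affine`), which means weights `(u,
u⁻¹)` for `n = 2` and a common sign for `n ≥ 4`. The image of `X` has degree one in `X` and central
coefficients, the leading one a unit.

In the Laurent extension all units are monomials `u t^v`, so an automorphism acts on `k[t^±1]`
through the torus and `GL_m(ℤ)` (`exists_torus`). Once this part is divided out, the automorphism is
linear over the domain `k[t^±1]`, and the description of automorphisms of `W_n` applies over that
base.

A locally nilpotent derivation `D` exponentiates to an automorphism `exp(X D)` of `W_n[X]`.
Automorphisms send `x_i` into `W_n`, so the coefficient `D x_i` of `X` vanishes. -/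

namespace WAlg

/-! ### The Fock representation of `W_n` -/

section Fock

variable (k : Type*) [CommRing k] {n : ℕ}

/-- The free module on the monomials in `n` variables. -/
abbrev Fock (k : Type*) [CommRing k] (n : ℕ) : Type _ := Multiset (Fin n) →₀ k

/-- The sign for moving the `i`-th variable past the smaller variables of the monomial `s`. -/
def fockSign (i : Fin n) (s : Multiset (Fin n)) : k := (-1) ^ s.countP (· < i)

theorem fockSign_cons (i j : Fin n) (s : Multiset (Fin n)) :
    fockSign k i (j ::ₘ s) = if j < i then -fockSign k i s else fockSign k i s := by
  unfold fockSign
  split_ifs with h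
  · rw [Multiset.countP_cons_of_pos (p := (· < i)) _ h, pow_succ]; ring
  · rw [Multiset.countP_cons_of_neg (p := (· < i)) _ h]

theorem fockSign_erase (i j : Fin n) {s : Multiset (Fin n)} (hj : j ∈ s) :
    fockSign k i (s.erase j) = if j < i then -fockSign k i s else fockSign k i s := by
  obtain ⟨t, rfl⟩ := Multiset.exists_cons_of_mem hj
  rw [Multiset.erase_cons_head, fockSign_cons]
  split_ifs <;> simp

theorem fockSign_mul_self (i : Fin n) (s : Multiset (Fin n)) :
    fockSign k i s * fockSign k i s = 1 := by
  rw [fockSign, ← mul_pow]; simp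

noncomputable section

/-- Signed multiplication by the `i`-th variable. -/
def raise (i : Fin n) : Module.End k (Fock k n) :=
  Finsupp.linearCombination k fun s => Finsupp.single (i ::ₘ s) (fockSign k i s)

/-- Signed removal of the `i`-th variable from the monomials in which its exponent is odd. -/
def lower (i : Fin n) : Module.End k (Fock k n) :=
  Finsupp.linearCombination k fun s =>
    if Odd (s.count i) then Finsupp.single (s.erase i) (fockSign k i s) else 0

theorem raise_single (i : Fin n) (s : Multiset (Fin n)) (a : k) :
    raise k i (Finsupp.single s a) = Finsupp.single (i ::ₘ s) (a * fockSign k i s) := by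
  simp [raise]

theorem lower_single (i : Fin n) (s : Multiset (Fin n)) (a : k) :
    lower k i (Finsupp.single s a) =
      if Odd (s.count i) then Finsupp.single (s.erase i) (a * fockSign k i s) else 0 := by
  simp [lower]

/-- Only the larger of two letters counts the smaller in its sign, so exactly one of the two orders
acquires an extra `-1`. -/
theorem raise_anticomm {i j : Fin n} (h : i ≠ j) :
    raise k i * raise k j + raise k j * raise k i = 0 := by
  ext s : 2
  simp only [LinearMap.comp_apply, Finsupp.lsingle_apply, LinearMap.add_apply,
    Module.End.mul_apply, raise_single, fockSign_cons, LinearMap.zero_apply,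
    Multiset.cons_swap i j, ← Finsupp.single_add]
  rw [Finsupp.single_eq_zero]
  rcases lt_or_gt_of_ne h with h | h
  · simp only [h, h.not_gt, if_true, if_false]; ring
  · simp only [h, h.not_gt, if_true, if_false]; ring

/-- For `i = j` the square vanishes, because removing a letter of odd exponent leaves an even
exponent. For `i ≠ j` the signs differ as for raising. -/
theorem lower_anticomm (i j : Fin n) : lower k i * lower k j + lower k j * lower k i = 0 := by
  ext s : 2
  simp only [LinearMap.comp_apply, Finsupp.lsingle_apply, LinearMap.add_apply,
    Module.End.mul_apply, lower_single, LinearMap.zero_apply]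
  rcases eq_or_ne i j with rfl | h
  · by_cases h1 : Odd (s.count i)
    · have hi : i ∈ s := Multiset.count_pos.1 h1.pos
      have : ¬ Odd ((s.erase i).count i) := by
        rw [Multiset.count_erase_self]
        rcases h1 with ⟨c, hc⟩
        rw [hc]; simp
      rw [if_pos h1, lower_single, if_neg this, add_zero]
    · rw [if_neg h1]; simp
  · by_cases h1 : Odd (s.count i) <;> by_cases h2 : Odd (s.count j)
    · have hi : i ∈ s := Multiset.count_pos.1 h1.pos
      have hj : j ∈ s := Multiset.count_pos.1 h2.pos
      rw [if_pos h1, if_pos h2, lower_single, lower_single,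
        if_pos (by rwa [Multiset.count_erase_of_ne h]),
        if_pos (by rwa [Multiset.count_erase_of_ne h.symm]), fockSign_erase k _ _ hi,
        fockSign_erase k _ _ hj, Multiset.erase_comm, ← Finsupp.single_add,
        Finsupp.single_eq_zero]
      rcases lt_or_gt_of_ne h with h | h
      · simp only [h, h.not_gt, if_true, if_false]; ring
      · simp only [h, h.not_gt, if_true, if_false]; ring
    · rw [if_pos h1, if_neg h2, lower_single,
        if_neg (by rwa [Multiset.count_erase_of_ne h.symm])]
      simp
    · rw [if_neg h1, if_pos h2, lower_single,
        if_neg (by rwa [Multiset.count_erase_of_ne h])]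
      simp
    · rw [if_neg h1, if_neg h2]; simp

/-- Raising flips the parity of the exponent of `i`, so on each monomial one product is the identity
and the other is zero. -/
theorem raise_lower_self (i : Fin n) : raise k i * lower k i + lower k i * raise k i = 1 := by
  ext s : 2
  simp only [LinearMap.comp_apply, Finsupp.lsingle_apply, LinearMap.add_apply,
    Module.End.mul_apply, lower_single, raise_single, Module.End.one_apply,
    Multiset.count_cons_self, Nat.odd_add_one, Multiset.erase_cons_head, fockSign_cons,
    lt_irrefl, if_false]
  by_cases h1 : Odd (s.count i)
  · have hi : i ∈ s := Multiset.count_pos.1 h1.pos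
    rw [if_pos h1, if_neg (by simpa using h1), raise_single, fockSign_erase k _ _ hi,
      Multiset.cons_erase hi]
    simp [fockSign_mul_self]
  · rw [if_neg h1, if_pos h1]
    simp [fockSign_mul_self]

theorem raise_lower {i j : Fin n} (h : i ≠ j) :
    raise k i * lower k j + lower k j * raise k i = 0 := by
  ext s : 2
  simp only [LinearMap.comp_apply, Finsupp.lsingle_apply, LinearMap.add_apply,
    Module.End.mul_apply, lower_single, raise_single, LinearMap.zero_apply,
    Multiset.count_cons_of_ne h.symm, fockSign_cons]
  by_cases h1 : Odd (s.count j)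
  · have hj : j ∈ s := Multiset.count_pos.1 h1.pos
    rw [if_pos h1, if_pos h1, raise_single, fockSign_erase k _ _ hj,
      Multiset.erase_cons_tail _ h, ← Finsupp.single_add, Finsupp.single_eq_zero]
    rcases lt_or_gt_of_ne h with h | h
    · simp only [h, h.not_gt, if_true, if_false]; ring
    · simp only [h, h.not_gt, if_true, if_false]; ring
  · rw [if_neg h1, if_neg h1]; simp

theorem raise_sum_lower (i : Fin n) (S : Finset (Fin n)) :
    raise k i * (∑ j ∈ S, lower k j) + (∑ j ∈ S, lower k j) * raise k i =
      if i ∈ S then 1 else 0 := by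
  rw [Finset.mul_sum, Finset.sum_mul, ← Finset.sum_add_distrib]
  rw [← Finset.sum_ite_eq S i fun _ => (1 : Module.End k (Fock k n))]
  refine Finset.sum_congr rfl fun j _ => ?_
  split_ifs with h
  · rw [h, raise_lower_self]
  · exact raise_lower k h

theorem sum_lower_anticomm (S T : Finset (Fin n)) :
    (∑ j ∈ S, lower k j) * (∑ j ∈ T, lower k j) +
      (∑ j ∈ T, lower k j) * (∑ j ∈ S, lower k j) = 0 := by
  rw [Finset.sum_mul_sum, Finset.sum_mul_sum, Finset.sum_comm (s := T),
    ← Finset.sum_add_distrib]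
  refine Finset.sum_eq_zero fun i _ => ?_
  rw [← Finset.sum_add_distrib]
  exact Finset.sum_eq_zero fun j _ => lower_anticomm k i j

/-- Left multiplication by `x_i` in terms of the basis of monomials. -/
def fockX (i : Fin n) : Module.End k (Fock k n) := raise k i + ∑ j ∈ Finset.Iio i, lower k j

/-- The lowering terms of `fockX` record the passage of `x_i` across smaller letters: since squares
are central, `x_i x_j^a` is `± x_j^a x_i`, plus `x_j^(a-1)` when `a` is odd. For `i < j` the
lowering part of `x_j` contains `lower k i`, while that of `x_i` lacks `lower k j`. Hence exactly
one mixed anticommutator contributes `1`. -/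
theorem fockX_anticomm_of_lt {i j : Fin n} (h : i < j) :
    fockX k i * fockX k j + fockX k j * fockX k i = 1 := by
  have h1 := raise_anticomm k h.ne
  have h2 := raise_sum_lower k i (Finset.Iio j)
  have h3 := raise_sum_lower k j (Finset.Iio i)
  have h4 := sum_lower_anticomm k (Finset.Iio i) (Finset.Iio j)
  rw [if_pos (Finset.mem_Iio.2 h)] at h2
  rw [if_neg (fun h' => h.not_gt (Finset.mem_Iio.1 h'))] at h3
  unfold fockX
  calc _ = (raise k i * raise k j + raise k j * raise k i) +
        (raise k i * (∑ l ∈ Finset.Iio j, lower k l) +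
          (∑ l ∈ Finset.Iio j, lower k l) * raise k i) +
        (raise k j * (∑ l ∈ Finset.Iio i, lower k l) +
          (∑ l ∈ Finset.Iio i, lower k l) * raise k j) +
        ((∑ l ∈ Finset.Iio i, lower k l) * (∑ l ∈ Finset.Iio j, lower k l) +
          (∑ l ∈ Finset.Iio j, lower k l) * (∑ l ∈ Finset.Iio i, lower k l)) := by
        noncomm_ring
    _ = 1 := by rw [h1, h2, h3, h4]; simp

theorem fockX_anticomm {i j : Fin n} (h : i ≠ j) :
    fockX k i * fockX k j + fockX k j * fockX k i = 1 := by
  rcases lt_or_gt_of_ne h with h | h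
  · exact fockX_anticomm_of_lt k h
  · rw [add_comm]; exact fockX_anticomm_of_lt k h

/-- The action of `W_n` on the free module on monomials. -/
def fockHom : WAlg k n →ₐ[k] Module.End k (Fock k n) :=
  RingQuot.liftAlgHom k ⟨FreeAlgebra.lift k fun i => fockX k i, by
    rintro _ _ ⟨i, j, h⟩
    simp only [map_add, map_mul, map_one, FreeAlgebra.lift_ι_apply]
    exact fockX_anticomm k h⟩

@[simp] theorem fockHom_x (i : Fin n) : fockHom k (x k i) = fockX k i := by
  simp [fockHom, x]

/-- The span of the monomials of degree less than `d`. -/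
def fockFilt (n d : ℕ) : Submodule k (Fock k n) :=
  Finsupp.supported k k {s | Multiset.card s < d}

theorem single_mem_fockFilt {d : ℕ} {s : Multiset (Fin n)} (h : Multiset.card s < d) (a : k) :
    Finsupp.single s a ∈ fockFilt k n d :=
  Finsupp.single_mem_supported k a h

theorem sum_lower_mem_fockFilt {d : ℕ} (S : Finset (Fin n)) {p : Fock k n}
    (hp : p ∈ fockFilt k n d) : (∑ j ∈ S, lower k j) p ∈ fockFilt k n d := by
  rw [LinearMap.sum_apply]
  refine Submodule.sum_mem _ fun j _ => ?_
  rw [lower, Finsupp.linearCombination_apply]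
  refine Submodule.sum_mem _ fun s hs => Submodule.smul_mem _ _ ?_
  have hs' : Multiset.card s < d := (Finsupp.mem_supported k p).1 hp hs
  split_ifs
  · exact single_mem_fockFilt k ((Multiset.card_le_card (Multiset.erase_le _ _)).trans_lt hs') _
  · exact Submodule.zero_mem _

theorem fockFilt_mono {d e : ℕ} (h : d ≤ e) : fockFilt k n d ≤ fockFilt k n e :=
  Finsupp.supported_mono fun _ hs => lt_of_lt_of_le hs h

theorem fockX_mem_fockFilt {d : ℕ} (i : Fin n) {p : Fock k n} (hp : p ∈ fockFilt k n d) :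
    fockX k i p ∈ fockFilt k n (d + 1) := by
  refine Submodule.add_mem _ ?_ (fockFilt_mono k d.le_succ (sum_lower_mem_fockFilt k _ hp))
  rw [raise, Finsupp.linearCombination_apply]
  refine Submodule.sum_mem _ fun s hs => Submodule.smul_mem _ _ (single_mem_fockFilt k ?_ _)
  have hs' : Multiset.card s < d := (Finsupp.mem_supported k p).1 hp hs
  simpa using hs'

end

end Fock

/-! ### Words, the filtration by length and the monomial basis -/

section Words

variable (k : Type*) [CommRing k] {n : ℕ}

noncomputable section

/-- The product of the generators along a list of indices. -/
def word (l : List (Fin n)) : WAlg k n := (l.map (x k)).prod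

@[simp] theorem word_nil : word k ([] : List (Fin n)) = 1 := rfl

@[simp] theorem word_cons (i : Fin n) (l : List (Fin n)) :
    word k (i :: l) = x k i * word k l := by
  simp [word]

theorem word_append (l l' : List (Fin n)) : word k (l ++ l') = word k l * word k l' := by
  simp [word]

/-- The span of the words of length less than `d`. -/
def filt (n d : ℕ) : Submodule k (WAlg k n) :=
  Submodule.span k {a | ∃ l : List (Fin n), l.length < d ∧ word k l = a}

theorem word_mem_filt {d : ℕ} {l : List (Fin n)} (h : l.length < d) : word k l ∈ filt k n d :=
  Submodule.subset_span ⟨l, h, rfl⟩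

theorem filt_mono {d e : ℕ} (h : d ≤ e) : filt k n d ≤ filt k n e :=
  Submodule.span_mono fun _ ⟨l, hl, hw⟩ => ⟨l, hl.trans_le h, hw⟩

theorem word_mul_mem_filt {d : ℕ} (l : List (Fin n)) {a : WAlg k n} (ha : a ∈ filt k n d) :
    word k l * a ∈ filt k n (l.length + d) := by
  induction ha using Submodule.span_induction with
  | mem a h =>
    obtain ⟨l', hl', rfl⟩ := h
    rw [← word_append]
    exact word_mem_filt k (by simpa using hl')
  | zero => simp
  | add a b _ _ ha hb => rw [mul_add]; exact Submodule.add_mem _ ha hb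
  | smul c a _ ha => rw [mul_smul_comm]; exact Submodule.smul_mem _ _ ha

theorem mul_word_mem_filt {d : ℕ} (l : List (Fin n)) {a : WAlg k n} (ha : a ∈ filt k n d) :
    a * word k l ∈ filt k n (d + l.length) := by
  induction ha using Submodule.span_induction with
  | mem a h =>
    obtain ⟨l', hl', rfl⟩ := h
    rw [← word_append]
    exact word_mem_filt k (by simpa using hl')
  | zero => simp
  | add a b _ _ ha hb => rw [add_mul]; exact Submodule.add_mem _ ha hb
  | smul c a _ ha => rw [smul_mul_assoc]; exact Submodule.smul_mem _ _ ha

theorem mul_mem_filt {d e : ℕ} {a b : WAlg k n} (ha : a ∈ filt k n d) (hb : b ∈ filt k n (e + 1)) :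
    a * b ∈ filt k n (d + e) := by
  induction hb using Submodule.span_induction with
  | mem b h =>
    obtain ⟨l', hl', rfl⟩ := h
    exact filt_mono k (by omega) (mul_word_mem_filt k l' ha)
  | zero => simp
  | add a b _ _ ha hb => rw [mul_add]; exact Submodule.add_mem _ ha hb
  | smul c a _ ha => rw [mul_smul_comm]; exact Submodule.smul_mem _ _ ha

/-- Reordering a word changes it by a sign, up to shorter words. -/
theorem word_perm {l l' : List (Fin n)} (h : l.Perm l') :
    ∃ ε : kˣ, word k l - (ε : k) • word k l' ∈ filt k n l.length := by
  induction h with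
  | nil => exact ⟨1, by simp⟩
  | @cons i l l' _ ih =>
    obtain ⟨ε, hε⟩ := ih
    refine ⟨ε, ?_⟩
    have := word_mul_mem_filt k [i] hε
    rw [word_cons, word_cons, ← mul_smul_comm, ← mul_sub]
    simpa [add_comm] using this
  | swap i j l =>
    rcases eq_or_ne i j with rfl | h
    · exact ⟨1, by simp⟩
    · refine ⟨-1, ?_⟩
      have : word k (j :: i :: l) - (((-1 : kˣ) : k)) • word k (i :: j :: l) = word k l := by
        rw [Units.val_neg, Units.val_one, sub_eq_add_neg,
          show (-1 : k) • word k (i :: j :: l) = -word k (i :: j :: l) by module,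
          neg_neg]
        simp only [word_cons, ← mul_assoc]
        rw [← add_mul, x_mul_x k h.symm, one_mul]
      rw [this]
      exact word_mem_filt k (by simp)
  | @trans l₁ l₂ l₃ h₁ _ ih₁ ih₂ =>
    obtain ⟨ε₁, h1⟩ := ih₁
    obtain ⟨ε₂, h2⟩ := ih₂
    refine ⟨ε₁ * ε₂, ?_⟩
    rw [← h₁.length_eq] at h2
    have := Submodule.add_mem _ h1 (Submodule.smul_mem _ (ε₁ : k) h2)
    rw [smul_sub, sub_add_sub_cancel, smul_smul] at this
    rwa [Units.val_mul]

/-- The monomial with exponents given by the multiset `s`. -/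
def mon (s : Multiset (Fin n)) : WAlg k n := word k s.toList

theorem word_sub_mon (l : List (Fin n)) :
    ∃ ε : kˣ, word k l - (ε : k) • mon k (l : Multiset (Fin n)) ∈ filt k n l.length :=
  word_perm k (Multiset.coe_eq_coe.1 (by rw [Multiset.coe_toList]))

theorem mon_mem_filt {d : ℕ} {s : Multiset (Fin n)} (h : Multiset.card s < d) :
    mon k s ∈ filt k n d :=
  word_mem_filt k (by simpa using h)

/-- By `word_sub_mon` a word is a unit multiple of a monomial modulo shorter words, and these are
covered by induction on `d`. -/
theorem filt_eq_span_mon (d : ℕ) :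
    filt k n d = Submodule.span k (mon k '' {s : Multiset (Fin n) | Multiset.card s < d}) := by
  apply le_antisymm
  · induction d with
    | zero =>
      refine Submodule.span_le.2 ?_
      rintro _ ⟨l, hl, _⟩
      omega
    | succ d ih =>
      have hle : filt k n d ≤
          Submodule.span k (mon k '' {s : Multiset (Fin n) | Multiset.card s < d + 1}) :=
        ih.trans (Submodule.span_mono (Set.image_mono fun s (hs : _ < d) => by
          change _ < d + 1; omega))
      refine Submodule.span_le.2 ?_
      rintro _ ⟨l, hl, rfl⟩
      obtain ⟨ε, hε⟩ := word_sub_mon k l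
      rw [SetLike.mem_coe, ← sub_add_cancel (word k l) ((ε : k) • mon k (l : Multiset (Fin n)))]
      refine Submodule.add_mem _ (hle (filt_mono k (by omega) hε)) (Submodule.smul_mem _ _ ?_)
      exact Submodule.subset_span ⟨_, by simpa using hl, rfl⟩
  · refine Submodule.span_le.2 ?_
    rintro _ ⟨s, hs, rfl⟩
    exact mon_mem_filt k hs

variable {k} in
@[elab_as_elim]
theorem induction {P : WAlg k n → Prop} (a : WAlg k n)
    (algebraMap : ∀ c, P (algebraMap k _ c)) (x : ∀ i, P (x k i))
    (mul : ∀ a b, P a → P b → P (a * b)) (add : ∀ a b, P a → P b → P (a + b)) : P a := by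
  obtain ⟨a, rfl⟩ := RingQuot.mkAlgHom_surjective k (WRel k n) a
  induction a using FreeAlgebra.induction with
  | grade0 c => rw [AlgHom.commutes]; exact algebraMap c
  | grade1 i => exact x i
  | mul a b ha hb => rw [map_mul]; exact mul _ _ ha hb
  | add a b ha hb => rw [map_add]; exact add _ _ ha hb

theorem exists_mem_filt (a : WAlg k n) : ∃ d, a ∈ filt k n d := by
  induction a using WAlg.induction with
  | algebraMap c =>
    refine ⟨1, ?_⟩
    rw [Algebra.algebraMap_eq_smul_one, ← word_nil]
    exact Submodule.smul_mem _ _ (word_mem_filt k (by simp))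
  | x i => exact ⟨2, by simpa using word_mem_filt k (l := [i]) (d := 2) (by simp)⟩
  | mul a b ha hb =>
    obtain ⟨d, hd⟩ := ha
    obtain ⟨e, he⟩ := hb
    exact ⟨d + e, mul_mem_filt k hd (filt_mono k e.le_succ he)⟩
  | add a b ha hb =>
    obtain ⟨d, hd⟩ := ha
    obtain ⟨e, he⟩ := hb
    exact ⟨max d e, Submodule.add_mem _ (filt_mono k (le_max_left _ _) hd)
      (filt_mono k (le_max_right _ _) he)⟩

/-- On the vacuum `single 0 1` each further letter raises the leading monomial up to sign, while the
lowering terms stay in smaller degree. -/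
theorem fockHom_word (l : List (Fin n)) :
    ∃ ε : kˣ, fockHom k (word k l) (Finsupp.single 0 1) -
      Finsupp.single (l : Multiset (Fin n)) (ε : k) ∈ fockFilt k n l.length := by
  induction l with
  | nil => exact ⟨1, by simp⟩
  | cons i l ih =>
    obtain ⟨ε, hε⟩ := ih
    have hu : IsUnit ((ε : k) * fockSign k i (l : Multiset (Fin n))) :=
      ε.isUnit.mul (IsUnit.of_mul_eq_one _ (fockSign_mul_self k i _))
    obtain ⟨η, hη⟩ := hu
    refine ⟨η, ?_⟩
    have h1 := fockX_mem_fockFilt k i hε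
    have h2 : (∑ j ∈ Finset.Iio i, lower k j) (Finsupp.single (l : Multiset (Fin n)) (ε : k)) ∈
        fockFilt k n (l.length + 1) :=
      sum_lower_mem_fockFilt k _ (single_mem_fockFilt k (by simp) _)
    have h3 : fockHom k (word k (i :: l)) (Finsupp.single 0 1) -
        Finsupp.single ((i :: l : List (Fin n)) : Multiset (Fin n)) (η : k) =
        fockX k i (fockHom k (word k l) (Finsupp.single 0 1) -
          Finsupp.single (l : Multiset (Fin n)) (ε : k)) +
        (∑ j ∈ Finset.Iio i, lower k j) (Finsupp.single (l : Multiset (Fin n)) (ε : k)) := by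
      rw [word_cons, map_mul, fockHom_x, Module.End.mul_apply, map_sub, hη, sub_add]
      congr 1
      rw [fockX, LinearMap.add_apply, add_sub_cancel_right, raise_single, Multiset.cons_coe]
    rw [h3]
    exact Submodule.add_mem _ h1 h2

/-- In degrees at least that of `s` the error term of `fockHom_word` is invisible. The action of the
monomials on the vacuum is thus triangular, with units on the diagonal. -/
theorem fockHom_mon (s : Multiset (Fin n)) :
    ∃ ε : kˣ, ∀ t : Multiset (Fin n), Multiset.card s ≤ Multiset.card t →
      fockHom k (mon k s) (Finsupp.single 0 1) t = if s = t then (ε : k) else 0 := by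
  obtain ⟨ε, hε⟩ := fockHom_word k s.toList
  refine ⟨ε, fun t ht => ?_⟩
  rw [Multiset.coe_toList, Multiset.length_toList] at hε
  have h0 := (Finsupp.mem_supported' k _).1 hε t (by simpa using ht)
  rw [Finsupp.sub_apply, sub_eq_zero] at h0
  rw [mon, h0, Finsupp.single_apply]

/-- In a nontrivial relation choose a monomial `t` of maximal degree. After acting on the vacuum,
the coefficient at `t` comes only from the term of `t` itself, with a unit factor. -/
theorem linearIndependent_mon : LinearIndependent k (mon k (n := n)) := by
  rw [linearIndependent_iff]
  intro c hc
  by_contra hne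
  obtain ⟨t, ht, hmax⟩ := Finset.exists_max_image c.support Multiset.card
    (Finsupp.support_nonempty_iff.2 hne)
  have h1 : fockHom k (Finsupp.linearCombination k (mon k) c) (Finsupp.single 0 1) t = 0 := by
    rw [hc]; simp
  rw [Finsupp.linearCombination_apply, Finsupp.sum, map_sum, LinearMap.sum_apply,
    Finsupp.finsetSum_apply, Finset.sum_eq_single t] at h1
  · obtain ⟨ε, hε⟩ := fockHom_mon k t
    rw [map_smul, LinearMap.smul_apply, Finsupp.smul_apply, hε t le_rfl, if_pos rfl, smul_eq_mul,
      Units.mul_left_eq_zero] at h1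
    exact (Finsupp.mem_support_iff.1 ht) h1
  · intro s hs hst
    obtain ⟨ε, hε⟩ := fockHom_mon k s
    rw [map_smul, LinearMap.smul_apply, Finsupp.smul_apply, hε t (hmax s hs), if_neg hst,
      smul_zero]
  · exact fun h => absurd ht h

/-- The monomials form a basis of `W_n`. -/
def monBasis (n : ℕ) : Module.Basis (Multiset (Fin n)) k (WAlg k n) :=
  Module.Basis.mk (linearIndependent_mon k) fun a _ => by
    obtain ⟨d, hd⟩ := exists_mem_filt k a
    rw [filt_eq_span_mon] at hd
    exact Submodule.span_mono (Set.image_subset_range _ _) hd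

@[simp] theorem monBasis_apply (s : Multiset (Fin n)) : monBasis k n s = mon k s := by
  simp [monBasis]

theorem mem_filt_iff {d : ℕ} {a : WAlg k n} :
    a ∈ filt k n d ↔ ∀ s, d ≤ Multiset.card s → (monBasis k n).repr a s = 0 := by
  rw [filt_eq_span_mon]
  have h : mon k (n := n) = monBasis k n := by ext; simp
  rw [h, Module.Basis.mem_span_image]
  constructor
  · intro H s hs
    by_contra hne
    have := H (Finsupp.mem_support_iff.2 hne)
    simp at this; omega
  · intro H s hs
    by_contra hne
    exact Finsupp.mem_support_iff.1 hs (H s (by simpa using hne))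

end

end Words

end WAlg

/-! ### The total degree on `W_n` -/

/-- `v` is a degree function: multiplicative, and non-increasing under addition. -/
structure IsDegree {B Γ : Type*} [Ring B] [AddCommMonoid Γ] [LinearOrder Γ]
    (v : B → WithBot Γ) : Prop where
  eq_bot_iff : ∀ a, v a = ⊥ ↔ a = 0
  one : v 1 = 0
  neg : ∀ a, v (-a) = v a
  add_le : ∀ a b, v (a + b) ≤ max (v a) (v b)
  mul : ∀ a b, v (a * b) = v a + v b

namespace WAlg

/-- Exponent vectors embed multisets into `ℕ^n`. Unique sums isolate one nonvanishing coefficient in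
a product of leading forms. -/
theorem uniqueSums_multiset (n : ℕ) : UniqueSums (Multiset (Fin n)) :=
  UniqueSums.of_injective_addHom (G := Fin n → ℕ)
    (f := { toFun := fun s i => s.count i, map_add' := fun s t => by ext; simp })
    (fun _ _ h => Multiset.ext.2 (congrFun h)) inferInstance

section Degree

variable {k : Type*} [CommRing k] {n : ℕ}

theorem mon_mul_mon (s t : Multiset (Fin n)) :
    ∃ ε : kˣ, mon k s * mon k t - (ε : k) • mon k (s + t) ∈
      filt k n (Multiset.card s + Multiset.card t) := by
  obtain ⟨ε, hε⟩ := word_sub_mon k (s.toList ++ t.toList)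
  refine ⟨ε, ?_⟩
  rwa [word_append, ← Multiset.coe_add, Multiset.coe_toList, Multiset.coe_toList,
    List.length_append, Multiset.length_toList, Multiset.length_toList] at hε

theorem repr_mon_mul_mon (s t : Multiset (Fin n)) :
    ∃ ε : kˣ, ∀ u : Multiset (Fin n), Multiset.card s + Multiset.card t ≤ Multiset.card u →
      (monBasis k n).repr (mon k s * mon k t) u = if s + t = u then (ε : k) else 0 := by
  obtain ⟨ε, hε⟩ := mon_mul_mon (k := k) s t
  refine ⟨ε, fun u hu => ?_⟩
  have h := (mem_filt_iff k).1 hε u hu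
  rw [map_sub, map_smul, ← monBasis_apply k (s + t), Module.Basis.repr_self, Finsupp.sub_apply,
    sub_eq_zero, Finsupp.smul_single, Finsupp.single_apply, smul_eq_mul, mul_one] at h
  exact h

theorem sum_repr_mon (a : WAlg k n) :
    ∑ s ∈ ((monBasis k n).repr a).support, (monBasis k n).repr a s • mon k s = a := by
  have h := (monBasis k n).linearCombination_repr a
  rw [Finsupp.linearCombination_apply, Finsupp.sum] at h
  simpa using h

theorem repr_mul (a b : WAlg k n) (u : Multiset (Fin n)) :
    (monBasis k n).repr (a * b) u =
      ∑ s ∈ ((monBasis k n).repr a).support, ∑ t ∈ ((monBasis k n).repr b).support,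
        (monBasis k n).repr a s * (monBasis k n).repr b t *
          (monBasis k n).repr (mon k s * mon k t) u := by
  conv_lhs => rw [← sum_repr_mon a, ← sum_repr_mon b]
  rw [Finset.sum_mul_sum]
  simp only [smul_mul_smul_comm, map_sum, map_smul, Finsupp.finsetSum_apply, Finsupp.smul_apply,
    smul_eq_mul]

/-- The total degree on `W_n`, all generators having degree `1`. -/
noncomputable def deg (a : WAlg k n) : WithBot ℕ :=
  ((monBasis k n).repr a).support.sup fun s => (Multiset.card s : WithBot ℕ)

theorem deg_lt_iff {a : WAlg k n} {d : ℕ} : deg a < d ↔ a ∈ filt k n d := by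
  have hd : (⊥ : WithBot ℕ) < (d : WithBot ℕ) := WithBot.bot_lt_coe d
  rw [deg, Finset.sup_lt_iff hd, mem_filt_iff]
  constructor
  · intro h s hs
    by_contra hne
    have := h s (Finsupp.mem_support_iff.2 hne)
    rw [Nat.cast_lt] at this
    omega
  · intro h s hs
    rw [Nat.cast_lt]
    by_contra hne
    exact Finsupp.mem_support_iff.1 hs (h s (by omega))

/-- The filtration is indexed by a strict bound on length, hence the shift by one. -/
theorem deg_le_iff {a : WAlg k n} {d : ℕ} : deg a ≤ d ↔ a ∈ filt k n (d + 1) := by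
  rw [← deg_lt_iff]
  induction deg a with
  | bot => simp
  | coe e => rw [← Nat.cast_withBot, Nat.cast_le, Nat.cast_lt]; omega

theorem deg_eq_bot_iff {a : WAlg k n} : deg a = ⊥ ↔ a = 0 := by
  constructor
  · intro h
    have h1 : deg a < ((0 : ℕ) : WithBot ℕ) := by rw [h]; exact WithBot.bot_lt_coe _
    rw [deg_lt_iff, mem_filt_iff] at h1
    apply (monBasis k n).repr.injective
    ext s
    rw [h1 s (Nat.zero_le _)]; simp
  · rintro rfl
    simp [deg]

theorem deg_add_le (a b : WAlg k n) : deg (a + b) ≤ max (deg a) (deg b) := by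
  obtain ⟨c, hc⟩ : ∃ c, c = max (deg a) (deg b) := ⟨_, rfl⟩
  rw [← hc]
  have ha : deg a ≤ c := hc ▸ le_max_left _ _
  have hb : deg b ≤ c := hc ▸ le_max_right _ _
  induction c with
  | bot =>
    rw [le_bot_iff, deg_eq_bot_iff] at ha hb
    rw [ha, hb, add_zero, le_bot_iff, deg_eq_bot_iff]
  | coe d => exact deg_le_iff.2 (Submodule.add_mem _ (deg_le_iff.1 ha) (deg_le_iff.1 hb))

theorem deg_neg (a : WAlg k n) : deg (-a) = deg a := by
  simp [deg]

theorem mon_zero : mon k (0 : Multiset (Fin n)) = 1 := by simp [mon]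

theorem mon_singleton (i : Fin n) : mon k {i} = x k i := by simp [mon]

variable (k n) in
theorem algebraMap_injective : Function.Injective (algebraMap k (WAlg k n)) := by
  intro c d h
  have h0 : ∀ c : k, (monBasis k n).repr (algebraMap k _ c) 0 = c := by
    intro c
    rw [Algebra.algebraMap_eq_smul_one, map_smul, ← mon_zero, ← monBasis_apply,
      Module.Basis.repr_self]
    simp
  rw [← h0 c, h, h0 d]

theorem deg_mon [Nontrivial k] (s : Multiset (Fin n)) :
    deg (mon k s) = (Multiset.card s : WithBot ℕ) := by
  rw [deg, ← monBasis_apply, Module.Basis.repr_self, Finsupp.support_single _ one_ne_zero,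
    Finset.sup_singleton]

theorem deg_one [Nontrivial k] : deg (1 : WAlg k n) = 0 := by
  rw [← mon_zero, deg_mon]; simp

theorem deg_x [Nontrivial k] (i : Fin n) : deg (x k i) = 1 := by
  rw [← mon_singleton, deg_mon]; simp

theorem exists_repr_ne_zero {a : WAlg k n} {d : ℕ} (h : deg a = d) :
    (∀ s, (monBasis k n).repr a s ≠ 0 → Multiset.card s ≤ d) ∧
      ∃ s, (monBasis k n).repr a s ≠ 0 ∧ Multiset.card s = d := by
  have h1 := (mem_filt_iff k).1 (deg_le_iff.1 h.le)
  have h2 : ∀ s, (monBasis k n).repr a s ≠ 0 → Multiset.card s ≤ d := by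
    intro s hs
    by_contra hne
    exact hs (h1 s (by omega))
  refine ⟨h2, ?_⟩
  by_contra! H
  have : deg a < d := by
    rw [deg_lt_iff, mem_filt_iff]
    intro s hs
    by_contra hne
    exact H s hne (le_antisymm (h2 s hne) hs)
  exact this.ne h

/-- Up to units and lower terms, leading forms multiply as in a commutative polynomial ring. Among
the top-degree monomials of `a` and `b` there is a pair whose sum arises only once, so its
coefficient in `a * b` is a product of nonzero elements of the domain `k`. -/
theorem deg_mul [IsDomain k] (a b : WAlg k n) : deg (a * b) = deg a + deg b := by
  rcases eq_or_ne (deg a) ⊥ with ha | ha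
  · rw [ha, deg_eq_bot_iff.1 ha, zero_mul, WithBot.bot_add]; exact deg_eq_bot_iff.2 rfl
  rcases eq_or_ne (deg b) ⊥ with hb | hb
  · rw [hb, deg_eq_bot_iff.1 hb, mul_zero, WithBot.add_bot]; exact deg_eq_bot_iff.2 rfl
  obtain ⟨d, hd⟩ := WithBot.ne_bot_iff_exists.1 ha
  obtain ⟨e, he⟩ := WithBot.ne_bot_iff_exists.1 hb
  obtain ⟨hA, s₁, hs₁, hs₁'⟩ := exists_repr_ne_zero hd.symm
  obtain ⟨hB, t₁, ht₁, ht₁'⟩ := exists_repr_ne_zero he.symm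
  have := uniqueSums_multiset n
  obtain ⟨s₀, hs₀, t₀, ht₀, huniq⟩ := UniqueSums.uniqueAdd_of_nonempty
    (A := {s ∈ ((monBasis k n).repr a).support | Multiset.card s = d})
    (B := {s ∈ ((monBasis k n).repr b).support | Multiset.card s = e})
    ⟨s₁, by simp [hs₁, hs₁']⟩ ⟨t₁, by simp [ht₁, ht₁']⟩
  simp only [Finset.mem_filter, Finsupp.mem_support_iff] at hs₀ ht₀
  have hcoef : (monBasis k n).repr (a * b) (s₀ + t₀) ≠ 0 := by
    rw [repr_mul, Finset.sum_eq_single s₀, Finset.sum_eq_single t₀]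
    · obtain ⟨ε, hε⟩ := repr_mon_mul_mon (k := k) s₀ t₀
      rw [hε _ (by simp), if_pos rfl]
      exact mul_ne_zero (mul_ne_zero hs₀.1 ht₀.1) ε.ne_zero
    · intro t ht hne
      obtain ⟨ε, hε⟩ := repr_mon_mul_mon (k := k) s₀ t
      have hc := hB t (Finsupp.mem_support_iff.1 ht)
      rw [hε _ (by simp; omega), if_neg (by simpa using hne), mul_zero]
    · intro h; exact absurd (Finsupp.mem_support_iff.2 ht₀.1) h
    · intro s hs hne
      refine Finset.sum_eq_zero fun t ht => ?_
      obtain ⟨ε, hε⟩ := repr_mon_mul_mon (k := k) s t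
      have hc := hB t (Finsupp.mem_support_iff.1 ht)
      have hc' := hA s (Finsupp.mem_support_iff.1 hs)
      rw [hε _ (by simp; omega), if_neg, mul_zero]
      -- Equality with `s₀ + t₀` forces both factors to have top degree, so uniqueness of the sum
      -- applies to them.
      intro heq
      have hcard := congrArg Multiset.card heq
      simp only [Multiset.card_add] at hcard
      refine hne (huniq ?_ ?_ heq).1
      · rw [Finset.mem_filter]; exact ⟨hs, by omega⟩
      · rw [Finset.mem_filter]; exact ⟨ht, by omega⟩
    · intro h; exact absurd (Finsupp.mem_support_iff.2 hs₀.1) h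
  apply le_antisymm
  · rw [← hd, ← he]
    refine (deg_le_iff (d := d + e)).2 (filt_mono k (by rw [add_right_comm])
      (mul_mem_filt k (d := d + 1) (e := e) ?_ ?_))
    · exact deg_le_iff.1 hd.symm.le
    · exact deg_le_iff.1 he.symm.le
  · by_contra! h
    rw [← hd, ← he] at h
    have := (mem_filt_iff k).1 (deg_lt_iff (d := d + e).1 h) (s₀ + t₀) (by simp [hs₀.2, ht₀.2])
    exact hcoef this

theorem isDegree_deg [IsDomain k] : IsDegree (deg : WAlg k n → WithBot ℕ) where
  eq_bot_iff _ := deg_eq_bot_iff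
  one := deg_one
  neg := deg_neg
  add_le := deg_add_le
  mul := deg_mul

instance [IsDomain k] : NoZeroDivisors (WAlg k n) where
  eq_zero_or_eq_zero_of_mul_eq_zero {a b} h := by
    rw [← deg_eq_bot_iff, deg_mul, WithBot.add_eq_bot, deg_eq_bot_iff, deg_eq_bot_iff] at h
    exact h

instance [IsDomain k] : Nontrivial (WAlg k n) :=
  ⟨1, 0, fun h => by simpa [deg_one] using deg_eq_bot_iff.2 h⟩

theorem mem_filt_one {a : WAlg k n} (h : a ∈ filt k n 1) : ∃ c : k, a = algebraMap k _ c := by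
  induction h using Submodule.span_induction with
  | mem a h =>
    obtain ⟨l, hl, rfl⟩ := h
    exact ⟨1, by rw [List.length_eq_zero_iff.1 (Nat.lt_one_iff.1 hl)]; simp⟩
  | zero => exact ⟨0, by simp⟩
  | add a b _ _ ha hb =>
    obtain ⟨c, rfl⟩ := ha
    obtain ⟨d, rfl⟩ := hb
    exact ⟨c + d, by simp⟩
  | smul c a _ ha =>
    obtain ⟨d, rfl⟩ := ha
    exact ⟨c * d, by rw [map_mul, Algebra.smul_def]⟩

theorem mem_filt_two {a : WAlg k n} (h : a ∈ filt k n 2) :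
    ∃ (c : k) (b : Fin n → k), a = algebraMap k _ c + ∑ j, b j • x k j := by
  induction h using Submodule.span_induction with
  | mem a h =>
    obtain ⟨l, hl, rfl⟩ := h
    rcases l with _ | ⟨i, l⟩
    · exact ⟨1, 0, by simp⟩
    · have : l = [] := by simpa using hl
      subst this
      exact ⟨0, Pi.single i 1, by simp [Pi.single_apply, ite_smul]⟩
  | zero => exact ⟨0, 0, by simp⟩
  | add a b _ _ ha hb =>
    obtain ⟨c, b, rfl⟩ := ha
    obtain ⟨c', b', rfl⟩ := hb
    refine ⟨c + c', b + b', ?_⟩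
    simp only [map_add, Pi.add_apply, add_smul, Finset.sum_add_distrib]
    abel
  | smul c a _ ha =>
    obtain ⟨d, b, rfl⟩ := ha
    refine ⟨c * d, c • b, ?_⟩
    simp only [map_mul, smul_add, Finset.smul_sum, Pi.smul_apply, smul_eq_mul, mul_smul]
    rw [← Algebra.smul_def]

theorem eq_algebraMap_of_deg_le {a : WAlg k n} (h : deg a ≤ 0) : ∃ c : k, a = algebraMap k _ c :=
  mem_filt_one (deg_le_iff (d := 0).1 h)

/-- The degrees of an element and its inverse are natural numbers with sum zero, so both are
scalars. -/
theorem eq_algebraMap_of_isUnit [IsDomain k] {a : WAlg k n} (h : IsUnit a) :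
    ∃ c : kˣ, a = algebraMap k _ (c : k) := by
  have key : ∀ a b : WAlg k n, a * b = 1 → ∃ c : k, a = algebraMap k _ c := by
    intro a b hab
    apply eq_algebraMap_of_deg_le
    have h1 := deg_mul a b
    rw [hab, deg_one] at h1
    revert h1
    induction deg a with
    | bot => simp
    | coe d =>
      induction deg b with
      | bot => intro h; exact absurd h (by simp)
      | coe e => 
        intro h
        simp only [← Nat.cast_withBot] at h ⊢
        norm_cast at h ⊢
        omega
  obtain ⟨⟨a, b, hab, hba⟩, rfl⟩ := h
  obtain ⟨c, rfl⟩ := key a b hab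
  obtain ⟨d, rfl⟩ := key b _ hba
  have hinj := algebraMap_injective k n
  refine ⟨⟨c, d, hinj (by simpa using hab), hinj (by simpa using hba)⟩, rfl⟩

end Degree

/-! ### The lexicographic degree on `W_n[X]` -/

section PolyDegree

variable {k : Type*} [CommRing k] {n : ℕ}

/-- The contribution of the term `a X ^ i` to the lexicographic degree. -/
noncomputable def termDeg (i : ℕ) (a : WAlg k n) : WithBot (ℕ ×ₗ ℕ) :=
  (deg a).map fun d => toLex (i, d)

theorem termDeg_mono {i : ℕ} {a b : WAlg k n} (h : deg a ≤ deg b) : termDeg i a ≤ termDeg i b := by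
  refine Monotone.withBot_map (fun d e hde => ?_) h
  exact Prod.Lex.toLex_le_toLex.2 (Or.inr ⟨rfl, hde⟩)

theorem termDeg_eq_bot_iff {i : ℕ} {a : WAlg k n} : termDeg i a = ⊥ ↔ a = 0 := by
  rw [termDeg, WithBot.map_eq_bot_iff, deg_eq_bot_iff]

theorem termDeg_le_of_lt {i j : ℕ} (h : i < j) (a : WAlg k n) {b : WAlg k n} (hb : b ≠ 0) :
    termDeg i a ≤ termDeg j b := by
  obtain ⟨e, he⟩ := WithBot.ne_bot_iff_exists.1 (mt deg_eq_bot_iff.1 hb)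
  rw [termDeg, termDeg, ← he]
  induction deg a with
  | bot => simp
  | coe d => exact WithBot.coe_le_coe.2 (Prod.Lex.toLex_le_toLex.2 (Or.inl h))

theorem termDeg_mul [IsDomain k] (i j : ℕ) (a b : WAlg k n) :
    termDeg (i + j) (a * b) = termDeg i a + termDeg j b := by
  rw [termDeg, termDeg, termDeg, deg_mul]
  induction deg a with
  | bot => simp
  | coe d =>
    induction deg b with
    | bot => simp
    | coe e => rfl

/-- The degree on `W_n[X]` that compares powers of `X` first and then the degree of the
coefficients. -/
noncomputable def polyDeg (p : (WAlg k n)[X]) : WithBot (ℕ ×ₗ ℕ) :=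
  p.support.sup fun i => termDeg i (p.coeff i)

theorem polyDeg_le_iff {p : (WAlg k n)[X]} {c : WithBot (ℕ ×ₗ ℕ)} :
    polyDeg p ≤ c ↔ ∀ i, termDeg i (p.coeff i) ≤ c := by
  rw [polyDeg, Finset.sup_le_iff]
  refine ⟨fun h i => ?_, fun h i _ => h i⟩
  by_cases hi : i ∈ p.support
  · exact h i hi
  · rw [termDeg_eq_bot_iff.2 (notMem_support_iff.1 hi)]; exact bot_le

/-- The power of `X` dominates, so only the leading coefficient matters. This reduces additivity on
`W_n[X]` to additivity on `W_n`. -/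
theorem polyDeg_eq (p : (WAlg k n)[X]) : polyDeg p = termDeg p.natDegree p.leadingCoeff := by
  apply le_antisymm
  · refine polyDeg_le_iff.2 fun i => ?_
    rcases lt_trichotomy i p.natDegree with h | h | h
    · refine termDeg_le_of_lt h _ (leadingCoeff_ne_zero.2 ?_)
      rintro rfl; simp at h
    · rw [h]; rfl
    · rw [termDeg_eq_bot_iff.2 (coeff_eq_zero_of_natDegree_lt h)]; exact bot_le
  · exact polyDeg_le_iff.1 le_rfl _

theorem isDegree_polyDeg [IsDomain k] :
    IsDegree (polyDeg : (WAlg k n)[X] → WithBot (ℕ ×ₗ ℕ)) where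
  eq_bot_iff p := by rw [polyDeg_eq, termDeg_eq_bot_iff, leadingCoeff_eq_zero]
  one := by rw [polyDeg_eq, natDegree_one, leadingCoeff_one, termDeg, deg_one]; rfl
  neg p := by rw [polyDeg_eq, polyDeg_eq, natDegree_neg, leadingCoeff_neg, termDeg, deg_neg]; rfl
  add_le p q := by
    refine polyDeg_le_iff.2 fun i => ?_
    rw [coeff_add]
    have h := deg_add_le (p.coeff i) (q.coeff i)
    rcases le_max_iff.1 h with h | h
    · exact (termDeg_mono h).trans ((polyDeg_le_iff.1 le_rfl i).trans (le_max_left _ _))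
    · exact (termDeg_mono h).trans ((polyDeg_le_iff.1 le_rfl i).trans (le_max_right _ _))
  mul p q := by
    rcases eq_or_ne p 0 with rfl | hp
    · simp [polyDeg]
    rcases eq_or_ne q 0 with rfl | hq
    · simp [polyDeg]
    rw [polyDeg_eq, polyDeg_eq, polyDeg_eq, natDegree_mul hp hq, leadingCoeff_mul, termDeg_mul]

theorem polyDeg_C (a : WAlg k n) : polyDeg (C a) = termDeg 0 a := by
  rw [polyDeg_eq, natDegree_C, leadingCoeff_C]

theorem eq_C_of_polyDeg_le {p : (WAlg k n)[X]} {d : ℕ}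
    (h : polyDeg p ≤ ((toLex (0, d) : ℕ ×ₗ ℕ) : WithBot (ℕ ×ₗ ℕ))) :
    ∃ a, deg a ≤ d ∧ p = C a := by
  rw [polyDeg_eq, termDeg] at h
  rcases eq_or_ne p 0 with rfl | hp
  · exact ⟨0, by rw [deg_eq_bot_iff.2 rfl]; exact bot_le, by simp⟩
  obtain ⟨e, he⟩ := WithBot.ne_bot_iff_exists.1 (mt deg_eq_bot_iff.1 (leadingCoeff_ne_zero.2 hp))
  rw [← he, WithBot.map_coe, WithBot.coe_le_coe, Prod.Lex.toLex_le_toLex] at h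
  have h0 : p.natDegree = 0 := by rcases h with h | h <;> simp_all
  refine ⟨p.coeff 0, ?_, eq_C_of_natDegree_eq_zero h0⟩
  rw [leadingCoeff, h0] at he
  rw [← he]
  rcases h with h | h
  · simp at h
  · exact WithBot.coe_le_coe.2 h.2

end PolyDegree

end WAlg

/-! ### Sums without cancellation -/

namespace IsDegree

variable {B Γ : Type*} [Ring B] [AddCommMonoid Γ] [LinearOrder Γ]
  {v : B → WithBot Γ}

theorem zero (hv : IsDegree v) : v 0 = ⊥ := (hv.eq_bot_iff 0).2 rfl

theorem add_lt (hv : IsDegree v) {a b : B} {N : WithBot Γ} (ha : v a < N) (hb : v b < N) :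
    v (a + b) < N :=
  (hv.add_le a b).trans_lt (max_lt ha hb)

theorem sub_lt (hv : IsDegree v) {a b : B} {N : WithBot Γ} (ha : v a < N) (hb : v b < N) :
    v (a - b) < N := by
  rw [sub_eq_add_neg]
  exact hv.add_lt ha (by rwa [hv.neg])

theorem sum_lt (hv : IsDegree v) {ι : Type*} {T : Finset ι} {b : ι → B} {N : WithBot Γ}
    (hN : N ≠ ⊥) (h : ∀ s ∈ T, v (b s) < N) : v (∑ s ∈ T, b s) < N :=
  Finset.sum_induction b (fun a => v a < N) (fun _ _ => hv.add_lt)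
    (by rw [hv.zero]; exact bot_lt_iff_ne_bot.2 hN) h

theorem prod_ne_bot (hv : IsDegree v) {κ : Type*} {g : κ → B} (hg : ∀ i, v (g i) ≠ ⊥)
    (l : List κ) : v (l.map g).prod ≠ ⊥ := by
  induction l with
  | nil => rw [List.map_nil, List.prod_nil, hv.one]; exact WithBot.coe_ne_bot
  | cons i l ih => rw [List.map_cons, List.prod_cons, hv.mul]; simp [hg, ih]

variable [IsOrderedCancelAddMonoid Γ]

/-- Elements of the same degree that commute up to distinct signs with the `g i`, up to lower
degree, have no cancellation in their sum. -/
theorem eq_empty_of_sum_lt (hv : IsDegree v) (h2 : v 2 = 0) {ι κ : Type*} (g : κ → B)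
    {N : WithBot Γ} (hN : N ≠ ⊥) (b : ι → B) (c : ι → κ → ℕ) (T : Finset ι)
    (hb : ∀ s ∈ T, v (b s) = N)
    (hc : ∀ s ∈ T, ∀ i, v (g i * b s - (-1) ^ c s i * (b s * g i)) < v (g i) + N)
    (hinj : ∀ s ∈ T, ∀ t ∈ T, (∀ i, Even (c s i) ↔ Even (c t i)) → s = t)
    (hsum : v (∑ s ∈ T, b s) < N) : T = ∅ := by
  classical
  induction T using Finset.strongInduction with
  | H T ih =>
    by_contra hne
    obtain ⟨s, hs⟩ := Finset.nonempty_iff_ne_empty.2 hne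
    by_cases hT : ∀ t ∈ T, t = s
    · rw [Finset.eq_singleton_iff_unique_mem.2 ⟨hs, hT⟩, Finset.sum_singleton, hb s hs] at hsum
      exact lt_irrefl _ hsum
    push Not at hT
    obtain ⟨t, ht, hts⟩ := hT
    obtain ⟨i, hi⟩ : ∃ i, ¬ (Even (c s i) ↔ Even (c t i)) := by
      by_contra! H
      exact hts (hinj s hs t ht H).symm
    -- The even terms for this `i` will be a nonempty proper subset: it contains the new `s` and
    -- omits the new `t`.
    obtain ⟨s, t, hs, ht, hsi, hti⟩ : ∃ s t, s ∈ T ∧ t ∈ T ∧ Even (c s i) ∧ ¬ Even (c t i) := by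
      by_cases h : Even (c s i)
      · exact ⟨s, t, hs, ht, h, by tauto⟩
      · exact ⟨t, s, ht, hs, by tauto, h⟩
    have hg : v (g i) ≠ ⊥ := by
      intro h
      have := hc s hs i
      rw [h, WithBot.bot_add] at this
      exact not_lt_bot this
    set a := ∑ s ∈ T, b s with ha
    set T' := T.filter fun s => Even (c s i) with hT'
    have h1 : v (g i * a + a * g i) < v (g i) + N := by
      apply hv.add_lt
      · rw [hv.mul]; exact WithBot.add_lt_add_left hg hsum
      · rw [hv.mul, add_comm (v a)]; exact WithBot.add_lt_add_left hg hsum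
    have hgN : v (g i) + N ≠ ⊥ := by simp [hg, hN]
    have h3 : v (∑ s ∈ T, (g i * b s - (-1) ^ c s i * (b s * g i))) < v (g i) + N :=
      hv.sum_lt hgN fun s hs => hc s hs i
    -- Up to the small errors of `hc`, anticommuting with `g i` doubles the terms of even sign and
    -- kills those of odd sign.
    have h4 : (2 : B) * (∑ s ∈ T', b s) * g i = (g i * a + a * g i) -
        ∑ s ∈ T, (g i * b s - (-1) ^ c s i * (b s * g i)) := by
      rw [ha, hT', Finset.sum_filter]
      simp only [Finset.mul_sum, Finset.sum_mul, ← Finset.sum_add_distrib,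
        ← Finset.sum_sub_distrib]
      refine Finset.sum_congr rfl fun s _ => ?_
      by_cases h : Even (c s i)
      · rw [if_pos h, h.neg_one_pow]; noncomm_ring
      · rw [if_neg h, (Nat.not_even_iff_odd.1 h).neg_one_pow]; noncomm_ring
    have h5 := hv.sub_lt h1 h3
    -- The factor `2` has degree zero and the degree of `g i` cancels, so the even terms alone
    -- already sum to something small.
    rw [← h4, hv.mul, hv.mul, h2, zero_add, add_comm (v (g i)),
      WithBot.add_lt_add_iff_right hg] at h5
    have hsub : T' ⊂ T := Finset.filter_ssubset.2 ⟨t, ht, hti⟩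
    have h6 := ih T' hsub (fun s hs => hb s (hsub.1 hs)) (fun s hs => hc s (hsub.1 hs))
      (fun s hs t ht => hinj s (hsub.1 hs) t (hsub.1 ht)) h5
    have h7 : s ∈ T' := Finset.mem_filter.2 ⟨hs, hsi⟩
    rw [h6] at h7
    exact Finset.notMem_empty _ h7

/-- If the sum were smaller than some term, the terms of maximal degree would cancel among
themselves, the remaining terms being of lower degree. `eq_empty_of_sum_lt` excludes this. -/
theorem le_sum (hv : IsDegree v) (h2 : v 2 = 0) {ι κ : Type*} (g : κ → B)
    (b : ι → B) (c : ι → κ → ℕ) (T : Finset ι)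
    (hc : ∀ s ∈ T, b s ≠ 0 → ∀ i,
      v (g i * b s - (-1) ^ c s i * (b s * g i)) < v (g i) + v (b s))
    (hinj : ∀ s ∈ T, ∀ t ∈ T, (∀ i, Even (c s i) ↔ Even (c t i)) → s = t) {s : ι} (hs : s ∈ T) :
    v (b s) ≤ v (∑ s ∈ T, b s) := by
  classical
  by_contra! hlt
  obtain ⟨t, ht, hmax⟩ := Finset.exists_max_image T (fun s => v (b s)) ⟨s, hs⟩
  have hlt' : v (∑ s ∈ T, b s) < v (b t) := hlt.trans_le (hmax s hs)
  have hN : v (b t) ≠ ⊥ := (bot_le.trans_lt hlt').ne'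
  have hne : ∀ s, v (b s) = v (b t) → b s ≠ 0 := fun s h h0 => hN (by rw [← h, h0, hv.zero])
  have h := hv.eq_empty_of_sum_lt h2 g hN b c (T.filter fun s => v (b s) = v (b t))
    (fun s hs => (Finset.mem_filter.1 hs).2)
    (fun s hs i => by
      obtain ⟨hs, hs'⟩ := Finset.mem_filter.1 hs
      rw [← hs']
      exact hc s hs (hne s hs') i)
    (fun s hs t ht => hinj s (Finset.mem_filter.1 hs).1 t (Finset.mem_filter.1 ht).1)
    (by
      rw [eq_sub_of_add_eq (Finset.sum_filter_add_sum_filter_not T _ b)]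
      refine hv.sub_lt hlt' (hv.sum_lt hN fun s hs => ?_)
      obtain ⟨hs, hs'⟩ := Finset.mem_filter.1 hs
      exact lt_of_le_of_ne (hmax s hs) hs')
  have h7 : t ∈ T.filter fun s => v (b s) = v (b t) := Finset.mem_filter.2 ⟨ht, rfl⟩
  rw [h] at h7
  exact Finset.notMem_empty _ h7

/-- Each letter different from `i` that `g i` passes contributes a sign and an error of lower
degree; a letter `i` commutes with `g i` and contributes neither. -/
theorem comm_prod_lt (hv : IsDegree v) {κ : Type*} [DecidableEq κ] {g : κ → B}
    (hg : ∀ i, v (g i) ≠ ⊥)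
    (hanti : ∀ i j, i ≠ j → v (g i * g j + g j * g i) < v (g i) + v (g j)) (i : κ) (l : List κ) :
    v (g i * (l.map g).prod - (-1) ^ l.countP (· ≠ i) * ((l.map g).prod * g i)) <
      v (g i) + v (l.map g).prod := by
  have hsign : ∀ c : ℕ, ∀ a : B, Commute ((-1 : B) ^ c) a := fun c a =>
    (Commute.neg_one_left a).pow_left c
  induction l with
  | nil => simp [hv.zero, hv.one, bot_lt_iff_ne_bot, hg]
  | cons j l ih =>
    have hl := hv.prod_ne_bot hg l
    rw [List.map_cons, List.prod_cons, hv.mul]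
    set p := (l.map g).prod
    rcases eq_or_ne j i with rfl | h
    · rw [List.countP_cons_of_neg (by simp)]
      have h1 : g j * (g j * p) - (-1) ^ l.countP (· ≠ j) * (g j * p * g j) =
          g j * (g j * p - (-1) ^ l.countP (· ≠ j) * (p * g j)) := by
        rw [mul_sub, ← mul_assoc (g j) ((-1) ^ _), ← (hsign _ (g j)).eq]
        simp only [mul_assoc]
      rw [h1, hv.mul]
      exact WithBot.add_lt_add_left (hg j) ih
    · rw [List.countP_cons_of_pos (by simpa using h), pow_succ]
      have h1 : g i * (g j * p) - (-1) ^ l.countP (· ≠ i) * -1 * (g j * p * g i) =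
          (g i * g j + g j * g i) * p -
            g j * (g i * p - (-1) ^ l.countP (· ≠ i) * (p * g i)) := by
        rw [mul_sub, ← mul_assoc (g j) ((-1) ^ _), ← (hsign _ (g j)).eq]
        noncomm_ring
      rw [h1]
      apply hv.sub_lt
      · rw [hv.mul, ← add_assoc]
        exact WithBot.add_lt_add_right hl (hanti i j h.symm)
      · rw [hv.mul, add_left_comm]
        exact WithBot.add_lt_add_left (hg j) ih

end IsDegree

/-- The parity of `(S.erase i).card` combines the parity of `S.card` with membership of `i`. If the
cardinalities of `S` and `T` have equal parity, the memberships agree; otherwise `T` is the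
complement of `S`, and the two cardinalities of different parity would add up to the even number
`n`. For odd `n` a set and its complement do give the same signs. -/
theorem finset_eq_of_even_card_erase {n : ℕ} (hn : Even n) {S T : Finset (Fin n)}
    (h : ∀ i, Even (S.erase i).card ↔ Even (T.erase i).card) : S = T := by
  have hS : ∀ (S : Finset (Fin n)) (i : Fin n),
      (Even (S.erase i).card ↔ (Even S.card ↔ i ∉ S)) := by
    intro S i
    by_cases hi : i ∈ S
    · have := Finset.card_erase_add_one hi
      simp only [hi, not_true, iff_false, ← this, Nat.even_add_one, not_not]
    · simp [hi]
  have h' : ∀ i, (Even S.card ↔ i ∉ S) ↔ (Even T.card ↔ i ∉ T) := fun i => by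
    rw [← hS, ← hS, h i]
  by_cases hpar : Even S.card ↔ Even T.card
  · ext i
    have := h' i
    tauto
  · exfalso
    have hc : T = Sᶜ := by
      ext i
      have := h' i
      rw [Finset.mem_compl]
      tauto
    have hcard := Finset.card_add_card_compl S
    rw [← hc, Fintype.card_fin] at hcard
    rw [← hcard, Nat.even_add] at hn
    exact hpar hn

/-- Central coefficients do not affect the commutation signs, and the sign of `g i` against the
product over `S` is governed by `(S.erase i).card`. For even `n` these signs separate the subsets,
so `le_sum` applies. -/
theorem IsDegree.le_sum_central_mul_prod {B Γ : Type*} [Ring B] [AddCommMonoid Γ] [LinearOrder Γ]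
    [IsOrderedCancelAddMonoid Γ] {v : B → WithBot Γ} (hv : IsDegree v) (h2 : v 2 = 0) {n : ℕ}
    (hn : Even n) {g : Fin n → B} (hg : ∀ i, v (g i) ≠ ⊥)
    (hanti : ∀ i j, i ≠ j → v (g i * g j + g j * g i) < v (g i) + v (g j))
    {r : Finset (Fin n) → B} (hr : ∀ S a, Commute (r S) a) (S : Finset (Fin n)) :
    v (r S) + v (S.toList.map g).prod ≤ v (∑ S, r S * (S.toList.map g).prod) := by
  have hcount : ∀ (S : Finset (Fin n)) i, S.toList.countP (· ≠ i) = (S.erase i).card := by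
    intro S i
    rw [← Finset.filter_ne', Finset.card_def, Finset.filter_val, ← Multiset.countP_eq_card_filter]
    conv_rhs => rw [← Finset.coe_toList S, Multiset.coe_countP]
  rw [← hv.mul]
  refine hv.le_sum h2 g (fun S => r S * (S.toList.map g).prod)
    (fun S i => S.toList.countP (· ≠ i)) Finset.univ ?_ ?_ (Finset.mem_univ S)
  · intro S _ h0 i
    have hrS : v (r S) ≠ ⊥ := by
      rw [Ne, hv.eq_bot_iff]
      rintro h
      exact h0 (by simp [h])
    have h := hv.comm_prod_lt hg hanti i S.toList
    set p := (S.toList.map g).prod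
    set c := S.toList.countP (· ≠ i)
    have h1 : g i * (r S * p) - (-1) ^ c * (r S * p * g i) =
        r S * (g i * p - (-1) ^ c * (p * g i)) := by
      rw [mul_sub, ← mul_assoc, ← (hr S (g i)).eq, ← mul_assoc (r S) ((-1) ^ c),
        (hr S ((-1) ^ c)).eq]
      simp only [mul_assoc]
    rw [h1, hv.mul, hv.mul, add_left_comm]
    exact WithBot.add_lt_add_left hrS h
  · intro S _ T _ h
    simp only [hcount] at h
    exact finset_eq_of_even_card_erase hn h

theorem sub_neg_one_pow_one_mul {B : Type*} [Ring B] (a b : B) : a - (-1) ^ 1 * b = a + b := by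
  rw [pow_one, neg_one_mul, sub_neg_eq_add]

/-! ### Squarefree forms and the centre -/

namespace WAlg

section Center

variable {k : Type*} [CommRing k] {n : ℕ}

/-- Moving `x_j` past two copies of `x_i` restores the sign, and the two correction terms cancel. -/
theorem commute_x_sq (i : Fin n) (a : WAlg k n) : Commute (x k i ^ 2) a := by
  induction a using WAlg.induction with
  | algebraMap c => exact Algebra.commute_algebraMap_right _ _
  | x j =>
    rcases eq_or_ne i j with rfl | h
    · exact (Commute.refl _).pow_left 2
    · have h1 : x k j * x k i = 1 - x k i * x k j := eq_sub_of_add_eq' (x_mul_x k h)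
      change x k i ^ 2 * x k j = x k j * x k i ^ 2
      rw [pow_two, ← mul_assoc, h1, sub_mul, one_mul, mul_assoc (x k i) (x k j), h1, mul_sub,
        mul_one, sub_sub_cancel, mul_assoc]
  | mul a b ha hb => exact ha.mul_right hb
  | add a b ha hb => exact ha.add_right hb

theorem commute_of_mem_squares {r : WAlg k n} (hr : r ∈ squares k n) (a : WAlg k n) :
    Commute r a := by
  induction hr using Algebra.adjoin_induction with
  | mem r h =>
    obtain ⟨i, rfl⟩ := h
    exact commute_x_sq i a
  | algebraMap c => exact Algebra.commute_algebraMap_left _ _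
  | add _ _ _ _ ha hb => exact ha.add_left hb
  | mul _ _ _ _ ha hb => exact ha.mul_left hb

/-- `a` is a combination of squarefree words with coefficients in `k[x_1^2, …, x_n^2]`. -/
def HasSquarefreeForm (a : WAlg k n) : Prop :=
  ∃ r : Finset (Fin n) → WAlg k n, (∀ S, r S ∈ squares k n) ∧ a = ∑ S, r S * word k S.toList

theorem HasSquarefreeForm.add {a b : WAlg k n} (ha : HasSquarefreeForm a)
    (hb : HasSquarefreeForm b) : HasSquarefreeForm (a + b) := by
  obtain ⟨r, hr, rfl⟩ := ha
  obtain ⟨s, hs, rfl⟩ := hb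
  exact ⟨r + s, fun S => Subalgebra.add_mem _ (hr S) (hs S), by
    simp [add_mul, Finset.sum_add_distrib]⟩

theorem HasSquarefreeForm.mul {a b : WAlg k n} (ha : a ∈ squares k n)
    (hb : HasSquarefreeForm b) : HasSquarefreeForm (a * b) := by
  obtain ⟨r, hr, rfl⟩ := hb
  exact ⟨fun S => a * r S, fun S => Subalgebra.mul_mem _ ha (hr S), by
    simp [Finset.mul_sum, mul_assoc]⟩

theorem hasSquarefreeForm_smul {a : WAlg k n} (c : k) (ha : HasSquarefreeForm a) :
    HasSquarefreeForm (c • a) := by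
  rw [Algebra.smul_def]
  exact ha.mul (Subalgebra.algebraMap_mem _ c)

theorem hasSquarefreeForm_finset (S : Finset (Fin n)) :
    HasSquarefreeForm (word k S.toList) := by
  classical
  refine ⟨Pi.single S 1, fun T => ?_, ?_⟩
  · rw [Pi.single_apply]
    split_ifs
    · exact Subalgebra.one_mem _
    · exact Subalgebra.zero_mem _
  · simp [Pi.single_apply, ite_mul]

/-- Modulo shorter words a word may be reordered. If a letter repeats, two copies are brought to the
front and their central square is absorbed into the coefficients, which leaves a shorter word. -/
theorem hasSquarefreeForm_of_mem_filt {d : ℕ} {a : WAlg k n} (h : a ∈ filt k n d) :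
    HasSquarefreeForm a := by
  induction d generalizing a with
  | zero =>
    have : a = 0 := by
      apply (monBasis k n).repr.injective
      ext s
      rw [(mem_filt_iff k).1 h s (Nat.zero_le _)]; simp
    exact ⟨0, fun _ => Subalgebra.zero_mem _, by simp [this]⟩
  | succ d ih =>
    have key : ∀ l l' : List (Fin n), l.length < d + 1 → l.Perm l' →
        HasSquarefreeForm (word k l') → HasSquarefreeForm (word k l) := by
      intro l l' hl hp hl'
      obtain ⟨ε, hε⟩ := word_perm k hp
      rw [← sub_add_cancel (word k l) ((ε : k) • word k l')]
      exact (ih (filt_mono k (by omega) hε)).add (hasSquarefreeForm_smul _ hl')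
    induction h using Submodule.span_induction with
    | mem a h =>
      obtain ⟨l, hl, rfl⟩ := h
      by_cases hnd : l.Nodup
      · refine key l l.toFinset.toList hl ?_ (hasSquarefreeForm_finset _)
        rw [← Multiset.coe_eq_coe, Finset.coe_toList, List.toFinset_val, hnd.dedup]
      · obtain ⟨i, hi⟩ := List.exists_duplicate_iff_not_nodup.2 hnd
        obtain ⟨t, ht⟩ := Multiset.le_iff_exists_add.1 (Multiset.coe_le.2
          (List.duplicate_iff_sublist.1 hi).subperm)
        have hcard := congrArg Multiset.card ht
        refine key l (i :: i :: t.toList) hl ?_ ?_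
        · rw [← Multiset.coe_eq_coe, ht, ← Multiset.cons_coe i (i :: t.toList),
            ← Multiset.cons_coe i t.toList, Multiset.coe_toList, ← Multiset.cons_coe,
            ← Multiset.cons_coe, Multiset.coe_nil, Multiset.cons_add, Multiset.cons_add, zero_add]
        · rw [word_cons, word_cons, ← mul_assoc, ← pow_two]
          refine (ih (word_mem_filt k ?_)).mul (Algebra.subset_adjoin (Set.mem_range_self i))
          simp at hcard ⊢; omega
    | zero => exact ⟨0, fun _ => Subalgebra.zero_mem _, by simp⟩
    | add a b _ _ ha hb => exact ha.add hb
    | smul c a _ ha => exact hasSquarefreeForm_smul _ ha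

theorem hasSquarefreeForm (a : WAlg k n) : HasSquarefreeForm a := by
  obtain ⟨d, hd⟩ := exists_mem_filt k a
  exact hasSquarefreeForm_of_mem_filt hd

theorem deg_algebraMap [IsDomain k] {c : k} (hc : c ≠ 0) : deg (algebraMap k (WAlg k n) c) = 0 := by
  apply le_antisymm
  · refine (deg_le_iff (d := 0)).2 ?_
    rw [Algebra.algebraMap_eq_smul_one, ← word_nil]
    exact Submodule.smul_mem _ _ (word_mem_filt k (by simp))
  · have : deg (algebraMap k (WAlg k n) c) ≠ ⊥ := by
      rw [Ne, deg_eq_bot_iff]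
      exact fun h => hc (algebraMap_injective k n (by rw [h, map_zero]))
    obtain ⟨e, he⟩ := WithBot.ne_bot_iff_exists.1 this
    rw [← he]
    exact WithBot.coe_le_coe.2 (Nat.zero_le e)

theorem map_x_prod (l : List (Fin n)) : (l.map (x k)).prod = word k l := rfl

variable [IsDomain k]

theorem deg_two (h2 : (2 : k) ≠ 0) : deg (2 : WAlg k n) = 0 := by
  rw [← map_ofNat (algebraMap k (WAlg k n)) 2]
  exact deg_algebraMap h2

/-- Subtracting the central element `a` from the coefficient of the empty word turns the squarefree
expansion of `a` into an expansion of zero with central coefficients. Without cancellation each term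
vanishes, so `a` equals the coefficient `r ∅`. -/
theorem mem_squares_of_central (h2 : (2 : k) ≠ 0) (hn : Even n) {a : WAlg k n}
    (ha : ∀ b, Commute a b) : a ∈ squares k n := by
  classical
  obtain ⟨r, hr, har⟩ := hasSquarefreeForm a
  have h := isDegree_deg.le_sum_central_mul_prod (deg_two h2) hn (g := x k)
    (fun i => by rw [deg_x]; exact WithBot.coe_ne_bot)
    (fun i j hij => by rw [x_mul_x k hij, deg_one, deg_x, deg_x]; decide)
    (r := Function.update r ∅ (r ∅ - a))
    (fun S b => by
      rw [Function.update_apply]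
      split_ifs
      · exact (commute_of_mem_squares (hr _) b).sub_left (ha b)
      · exact commute_of_mem_squares (hr _) b) ∅
  have h0 : ∑ S, Function.update r ∅ (r ∅ - a) S * (S.toList.map (x k)).prod = 0 := by
    rw [← Finset.add_sum_erase _ _ (Finset.mem_univ ∅)]
    rw [← Finset.add_sum_erase _ _ (Finset.mem_univ ∅)] at har
    rw [Finset.sum_congr rfl fun S hS => by
      rw [Function.update_of_ne (Finset.ne_of_mem_erase hS), map_x_prod]]
    rw [Function.update_self, Finset.toList_empty, map_x_prod, word_nil, mul_one, sub_add_eq_add_sub]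
    rw [Finset.toList_empty, word_nil, mul_one] at har
    rw [← har, sub_self]
  rw [h0, isDegree_deg.zero, le_bot_iff, Finset.toList_empty, List.map_nil, List.prod_nil,
    deg_one, add_zero, deg_eq_bot_iff, Function.update_self, sub_eq_zero] at h
  rw [← h]
  exact hr ∅

/-- Write `a = c + ∑ b_j x_j`. The central element `c - a` commutes with every generator, whereas a
nonzero `b_j x_j` commutes with `x_j` and anticommutes with the others up to lower degree. For `n ≥
2` these sign patterns are distinct, and the terms sum to zero, so `c - a` vanishes. -/
theorem eq_algebraMap_of_central (h2 : (2 : k) ≠ 0) (hn : 2 ≤ n) {a : WAlg k n}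
    (ha : ∀ b, Commute a b) (hd : a ∈ filt k n 2) : ∃ c : k, a = algebraMap k _ c := by
  classical
  obtain ⟨c, b, hcb⟩ := mem_filt_two hd
  refine ⟨c, ?_⟩
  have hother : ∀ i : Fin n, ∃ j, j ≠ i := fun i => by
    have : Nontrivial (Fin n) := Fin.nontrivial_iff_two_le.2 hn
    exact exists_ne i
  have h := isDegree_deg.le_sum (deg_two h2) (x k)
    (fun s : Option (Fin n) => s.elim (algebraMap k _ c - a) fun j => b j • x k j)
    (fun s i => s.elim 0 fun j => if i = j then 0 else 1) Finset.univ
    (by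
      rintro (_ | j) _ hne i
      · have hcomm : Commute (algebraMap k _ c - a) (x k i) :=
          (Algebra.commute_algebraMap_left _ _).sub_left (ha _)
        have hne' : deg (algebraMap k (WAlg k n) c - a) ≠ ⊥ := by
          rwa [Ne, deg_eq_bot_iff]
        simp only [Option.elim_none, pow_zero, one_mul]
        rw [hcomm.eq, sub_self, isDegree_deg.zero, bot_lt_iff_ne_bot, deg_x]
        simpa using hne'
      · simp only [Option.elim_some] at hne ⊢
        have hb : b j ≠ 0 := by rintro h; exact hne (by rw [h, zero_smul])
        rw [Algebra.smul_def, deg_mul, deg_x, deg_x, deg_algebraMap hb, ← Algebra.smul_def]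
        split_ifs with hij
        · rw [hij, pow_zero, one_mul, mul_smul_comm, smul_mul_assoc, sub_self, isDegree_deg.zero]
          decide
        · rw [sub_neg_one_pow_one_mul, mul_smul_comm, smul_mul_assoc, ← smul_add,
            x_mul_x k hij, ← Algebra.algebraMap_eq_smul_one, deg_algebraMap hb]
          decide)
    (by
      rintro (_ | j) _ (_ | j') _ h
      · rfl
      · obtain ⟨i, hi⟩ := hother j'
        have := h i
        simp [hi] at this
      · obtain ⟨i, hi⟩ := hother j
        have := h i
        simp [hi] at this
      · have := h j
        by_cases hjj : j = j'
        · rw [hjj]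
        · simp [hjj] at this)
    (Finset.mem_univ none)
  rw [Fintype.sum_option] at h
  simp only [Option.elim_none, Option.elim_some] at h
  rw [sub_add_eq_add_sub, ← hcb, sub_self, isDegree_deg.zero, le_bot_iff, deg_eq_bot_iff,
    sub_eq_zero] at h
  exact h.symm

end Center

/-! ### Images of the generators under automorphisms of `W_n[X]` -/

section PolyAut

variable {k : Type*} [CommRing k] {n : ℕ}

theorem commute_C_of_central {a : WAlg k n} (ha : ∀ b, Commute a b) (p : (WAlg k n)[X]) :
    Commute (C a) p := by
  ext i
  rw [coeff_C_mul, coeff_mul_C, (ha _).eq]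

theorem exists_central_form (p : (WAlg k n)[X]) :
    ∃ r : Finset (Fin n) → (WAlg k n)[X], (∀ S q, Commute (r S) q) ∧
      p = ∑ S, r S * C (word k S.toList) := by
  induction p using Polynomial.induction_on' with
  | add p q hp hq =>
    obtain ⟨r, hr, rfl⟩ := hp
    obtain ⟨s, hs, rfl⟩ := hq
    exact ⟨r + s, fun S q => (hr S q).add_left (hs S q), by
      simp [add_mul, Finset.sum_add_distrib]⟩
  | monomial i a =>
    obtain ⟨r, hr, har⟩ := hasSquarefreeForm a
    refine ⟨fun S => C (r S) * X ^ i, fun S q => ?_, ?_⟩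
    · exact (commute_C_of_central (commute_of_mem_squares (hr S)) q).mul_left (commute_X_pow q i)
    · rw [← C_mul_X_pow_eq_monomial, har, map_sum, Finset.sum_mul]
      refine Finset.sum_congr rfl fun S _ => ?_
      rw [C_mul, mul_assoc, mul_assoc, commute_X_pow]

theorem zero_le_lex (d : ℕ ×ₗ ℕ) : toLex (0, 0) ≤ d := by
  rcases Nat.eq_zero_or_pos (ofLex d).1 with h | h
  · exact Prod.Lex.le_iff.2 (Or.inr ⟨h.symm, Nat.zero_le _⟩)
  · exact Prod.Lex.le_iff.2 (Or.inl h)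

theorem one_le_lex {d : ℕ ×ₗ ℕ} (h : ¬ d ≤ toLex (0, 0)) : toLex (0, 1) ≤ d := by
  rw [Prod.Lex.le_iff] at h ⊢
  simp at h ⊢
  omega

/-- The degree of the generators in `W_n[X]`. -/
abbrev unitDeg : WithBot (ℕ ×ₗ ℕ) := ((toLex (0, 1) : ℕ ×ₗ ℕ) : WithBot (ℕ ×ₗ ℕ))

theorem eq_algebraMap_of_polyDeg_le {p : (WAlg k n)[X]} (h : polyDeg p ≤ 0) :
    ∃ c : k, p = algebraMap k _ c := by
  obtain ⟨a, ha, rfl⟩ := eq_C_of_polyDeg_le (d := 0) h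
  obtain ⟨c, rfl⟩ := eq_algebraMap_of_deg_le ha
  exact ⟨c, rfl⟩

variable [IsDomain k]

theorem polyDeg_C_x (i : Fin n) : polyDeg (C (x k i)) = unitDeg := by
  rw [polyDeg_C, termDeg, deg_x]; rfl

theorem polyDeg_two (h2 : (2 : k) ≠ 0) : polyDeg (2 : (WAlg k n)[X]) = 0 := by
  rw [← map_ofNat (C : WAlg k n →+* _) 2, polyDeg_C, termDeg, deg_two h2]; rfl

theorem zero_le_polyDeg {p : (WAlg k n)[X]} (hp : p ≠ 0) : 0 ≤ polyDeg p := by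
  obtain ⟨d, hd⟩ := WithBot.ne_bot_iff_exists.1 (mt (isDegree_polyDeg.eq_bot_iff p).1 hp)
  rw [← hd]
  exact WithBot.coe_le_coe.2 (zero_le_lex d)

/-- Scalars are fixed by `φ`, so the nonscalar `x_i` has a nonscalar image. Elements of degree at
most `(0, 0)` are scalars, and the next lexicographic degree is `(0, 1)`. -/
theorem unitDeg_le_polyDeg_map (φ : (WAlg k n)[X] ≃ₐ[k] (WAlg k n)[X]) (i : Fin n) :
    unitDeg ≤ polyDeg (φ (C (x k i))) := by
  have hx : ∀ c : k, φ (C (x k i)) ≠ algebraMap k _ c := by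
    intro c h
    rw [← φ.commutes c, φ.injective.eq_iff] at h
    have h' := C_injective (show C (x k i) = C (algebraMap k _ c) from h)
    have hd := deg_x (k := k) i
    rw [h'] at hd
    rcases eq_or_ne c 0 with rfl | hc
    · rw [map_zero, deg_eq_bot_iff.2 rfl] at hd
      exact absurd hd (by decide)
    · rw [deg_algebraMap hc] at hd
      exact absurd hd (by decide)
  have hne : φ (C (x k i)) ≠ 0 := by simpa using hx 0
  obtain ⟨d, hd⟩ := WithBot.ne_bot_iff_exists.1 (mt (isDegree_polyDeg.eq_bot_iff _).1 hne)
  rw [← hd]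
  refine WithBot.coe_le_coe.2 (one_le_lex fun h => ?_)
  obtain ⟨c, hc⟩ := eq_algebraMap_of_polyDeg_le (p := φ (C (x k i)))
    (by rw [← hd]; exact WithBot.coe_le_coe.2 h)
  exact hx c hc

/-- Applying `φ` to the central expansion of `φ⁻¹(x_i)` writes `x_i` as a sum of central multiples
of products of the `g j = φ(x_j)`. Each term is bounded by the degree of `x_i`, while each `g j` has
at least that degree. -/
theorem symm_map_C_x (h2 : (2 : k) ≠ 0) (hn : 2 ≤ n) (hne : Even n)
    (φ : (WAlg k n)[X] ≃ₐ[k] (WAlg k n)[X]) (i : Fin n) :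
    ∃ a ∈ filt k n 2, φ.symm (C (x k i)) = C a := by
  obtain ⟨r, hr, hsum⟩ := exists_central_form (φ.symm (C (x k i)))
  set g : Fin n → (WAlg k n)[X] := fun j => φ (C (x k j)) with hgdef
  have hword : ∀ l : List (Fin n), φ (C (word k l)) = (l.map g).prod := by
    intro l
    rw [word, map_list_prod, map_list_prod, List.map_map, List.map_map]; rfl
  have hg1 : ∀ j, unitDeg ≤ polyDeg (g j) := unitDeg_le_polyDeg_map φ
  have hg : ∀ j, polyDeg (g j) ≠ ⊥ := fun j h => by
    have := hg1 j
    rw [h, le_bot_iff] at this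
    exact WithBot.coe_ne_bot this
  have hcentral : ∀ S q, Commute (φ (r S)) q := fun S q => by
    have := (hr S (φ.symm q)).map φ
    rwa [φ.apply_symm_apply] at this
  have hle := isDegree_polyDeg.le_sum_central_mul_prod (polyDeg_two h2) hne hg
    (fun i j hij => by
      have h1 : g i * g j + g j * g i = 1 := by
        simp only [hgdef]
        rw [← map_mul φ, ← map_mul φ, ← map_add φ, ← C_mul, ← C_mul, ← C_add, x_mul_x k hij, C_1,
          map_one]
      rw [h1, isDegree_polyDeg.one]
      exact lt_of_lt_of_le (by decide) (add_le_add (hg1 i) (hg1 j))) hcentral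
  have hsum' : ∑ S, φ (r S) * (S.toList.map g).prod = C (x k i) := by
    rw [← φ.apply_symm_apply (C (x k i)), hsum, map_sum]
    exact Finset.sum_congr rfl fun S _ => by rw [map_mul, hword]
  rw [hsum', polyDeg_C_x] at hle
  have hterm : ∀ S, ∃ a ∈ filt k n 2, r S * C (word k S.toList) = C a := by
    intro S
    rcases eq_or_ne (r S) 0 with h0 | h0
    · exact ⟨0, Submodule.zero_mem _, by simp [h0]⟩
    have hS := hle S
    have hv0 : 0 ≤ polyDeg (φ (r S)) := zero_le_polyDeg (by simpa using h0)
    have hscal : ∀ c : k, φ (r S) = algebraMap k _ c → r S = C (algebraMap k _ c) := by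
      intro c hc
      apply φ.injective
      rw [hc]
      exact (φ.commutes c).symm
    rcases hl : S.toList with _ | ⟨j, _ | ⟨j', l⟩⟩
    -- Empty `S`: the degree bound alone allows an affine element of `W_n`, but central affine
    -- elements are scalars.
    · rw [hl, List.map_nil, List.prod_nil, isDegree_polyDeg.one, add_zero] at hS
      obtain ⟨a, ha, hra⟩ := eq_C_of_polyDeg_le hS
      have hac : ∀ b, Commute a b := fun b => by
        have := hcentral S (C b)
        rw [hra] at this
        exact C_injective (by rw [C_mul, C_mul]; exact this)
      obtain ⟨c, hc⟩ := eq_algebraMap_of_central h2 hn hac (deg_le_iff.1 ha)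
      rw [hscal c (by rw [hra, hc]; rfl), word_nil, C_1, mul_one]
      refine ⟨_, ?_, rfl⟩
      rw [Algebra.algebraMap_eq_smul_one, ← word_nil]
      exact Submodule.smul_mem _ _ (word_mem_filt k (by simp))
    -- One letter: it uses up the whole degree, so the coefficient is a scalar.
    · rw [hl, List.map_singleton, List.prod_singleton] at hS
      have hr0 : polyDeg (φ (r S)) ≤ 0 := by
        have := (add_le_add_right (hg1 j) (polyDeg (φ (r S)))).trans hS
        rw [← zero_add unitDeg] at this
        exact (WithBot.add_le_add_iff_right WithBot.coe_ne_bot).1 (by simpa using this)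
      obtain ⟨c, hc⟩ := eq_algebraMap_of_polyDeg_le hr0
      rw [hscal c hc, ← C_mul, ← Algebra.smul_def]
      exact ⟨_, Submodule.smul_mem _ _ (word_mem_filt k (by simp)), rfl⟩
    -- Two or more letters: the degree is at least `(0, 2)`.
    · exfalso
      rw [hl, List.map_cons, List.map_cons, List.prod_cons, List.prod_cons, isDegree_polyDeg.mul,
        isDegree_polyDeg.mul] at hS
      have hrest : 0 ≤ polyDeg (l.map g).prod := by
        apply zero_le_polyDeg
        rw [Ne, ← isDegree_polyDeg.eq_bot_iff]
        exact isDegree_polyDeg.prod_ne_bot hg l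
      have := (add_le_add hv0 (add_le_add (hg1 j) (add_le_add (hg1 j') hrest))).trans hS
      exact absurd this (by decide)
  choose a ha haeq using hterm
  refine ⟨∑ S, a S, Submodule.sum_mem _ fun S _ => ha S, ?_⟩
  rw [hsum, map_sum]
  exact Finset.sum_congr rfl fun S _ => haeq S

/-- Automorphisms of `W_n[X]` map the generators of `W_n` to affine combinations of them. -/
theorem map_C_x (h2 : (2 : k) ≠ 0) (hn : 2 ≤ n) (hne : Even n)
    (φ : (WAlg k n)[X] ≃ₐ[k] (WAlg k n)[X]) (i : Fin n) :
    ∃ a ∈ filt k n 2, φ (C (x k i)) = C a :=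
  symm_map_C_x h2 hn hne φ.symm i

end PolyAut

end WAlg

/-! ### Affine solutions of the relations and automorphisms of `W_n` -/

namespace WAlg

section Affine

variable {k : Type*} [CommRing k] {n : ℕ}

theorem repr_of_mem_filt {d : ℕ} {a : WAlg k n} (h : a ∈ filt k n d) {s : Multiset (Fin n)}
    (hs : d ≤ Multiset.card s) : (monBasis k n).repr a s = 0 :=
  (mem_filt_iff k).1 h s hs

theorem repr_x (i j : Fin n) : (monBasis k n).repr (x k i) {j} = if i = j then 1 else 0 := by
  rw [← mon_singleton, ← monBasis_apply, Module.Basis.repr_self, Finsupp.single_apply]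
  simp

theorem algebraMap_mem_filt (c : k) : algebraMap k (WAlg k n) c ∈ filt k n 1 := by
  rw [Algebra.algebraMap_eq_smul_one, ← word_nil]
  exact Submodule.smul_mem _ _ (word_mem_filt k (by simp))

theorem x_mem_filt (i : Fin n) : x k i ∈ filt k n 2 := by
  simpa using word_mem_filt k (l := [i]) (d := 2) (by simp)

theorem repr_one_singleton (j : Fin n) : (monBasis k n).repr 1 {j} = 0 := by
  rw [← map_one (algebraMap k _)]
  exact repr_of_mem_filt (algebraMap_mem_filt 1) (by simp)

/-- Only `x_j * x_j` reaches the monomial `{j, j}`. The unit depends on `j` alone, so it is shared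
by the products of two affine elements in either order. -/
theorem repr_affine_mul_affine (j : Fin n) : ∃ ε : kˣ, ∀ (c c' : k) (b b' : Fin n → k),
    (monBasis k n).repr ((algebraMap k _ c + ∑ l, b l • x k l) *
      (algebraMap k _ c' + ∑ l, b' l • x k l)) {j, j} = b j * b' j * ε := by
  classical
  obtain ⟨ε, hε⟩ := repr_mon_mul_mon (k := k) {j} {j}
  refine ⟨ε, fun c c' b b' => ?_⟩
  have hlin : ∀ b : Fin n → k, ∑ l, b l • x k l ∈ filt k n 2 := fun b =>
    Submodule.sum_mem _ fun l _ => Submodule.smul_mem _ _ (x_mem_filt l)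
  have haff : algebraMap k (WAlg k n) c' + ∑ l, b' l • x k l ∈ filt k n 2 :=
    Submodule.add_mem _ (filt_mono k (by norm_num) (algebraMap_mem_filt c')) (hlin b')
  have h1 := mul_mem_filt k (d := 1) (e := 1) (algebraMap_mem_filt c) haff
  have h2 := mul_mem_filt k (d := 2) (e := 0) (hlin b) (algebraMap_mem_filt c')
  have hcard : Multiset.card ({j, j} : Multiset (Fin n)) = 2 := by simp
  have hx : ∀ l m : Fin n, (monBasis k n).repr (x k l * x k m) {j, j} =
      if l = j ∧ m = j then (ε : k) else 0 := by
    intro l m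
    by_cases h : l = j ∧ m = j
    · rw [if_pos h, h.1, h.2, ← mon_singleton, hε _ (by simp), if_pos (by rfl)]
    · obtain ⟨ε', hε'⟩ := repr_mon_mul_mon (k := k) {l} {m}
      rw [if_neg h, ← mon_singleton, ← mon_singleton, hε' _ (by simp), if_neg]
      intro heq
      have hl : l ∈ ({j, j} : Multiset (Fin n)) := by rw [← heq]; simp
      have hm : m ∈ ({j, j} : Multiset (Fin n)) := by rw [← heq]; simp
      simp at hl hm
      exact h ⟨hl, hm⟩
  rw [add_mul, mul_add (∑ l, b l • x k l), map_add, map_add, Finsupp.add_apply, Finsupp.add_apply,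
    repr_of_mem_filt h1 (by simp), repr_of_mem_filt h2 (by simp), zero_add, zero_add,
    Finset.sum_mul_sum]
  simp only [smul_mul_smul_comm, map_sum, map_smul, Finsupp.finsetSum_apply, Finsupp.smul_apply,
    hx, smul_eq_mul, mul_ite, mul_zero]
  rw [Finset.sum_eq_single j, Finset.sum_eq_single j]
  · simp
  · intro m _ hm; rw [if_neg (by tauto)]
  · intro h; exact absurd (Finset.mem_univ _) h
  · intro l _ hl
    exact Finset.sum_eq_zero fun m _ => by rw [if_neg (by tauto)]
  · intro h; exact absurd (Finset.mem_univ _) h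

theorem affine_anticomm {i j : Fin n} (hij : i ≠ j) {α β α' β' : k}
    (h : (algebraMap k _ β + α • x k i) * (algebraMap k _ β' + α' • x k j) +
      (algebraMap k _ β' + α' • x k j) * (algebraMap k _ β + α • x k i) = (1 : WAlg k n)) :
    2 * (β * α') = 0 ∧ 2 * (β' * α) = 0 ∧ 2 * (β * β') + α * α' = 1 := by
  have h1 : (2 * (β * β') + α * α' - 1) • (1 : WAlg k n) + (2 * (β * α')) • x k j +
      (2 * (β' * α)) • x k i = 0 := by
    have hyx : x k j * x k i = 1 - x k i * x k j := eq_sub_of_add_eq' (x_mul_x k hij)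
    simp only [Algebra.algebraMap_eq_smul_one, add_mul, mul_add, smul_mul_smul_comm, mul_one,
      one_mul, hyx, smul_sub] at h
    rw [← sub_eq_zero] at h
    rw [← h]
    module
  have hi := congrArg (fun a => (monBasis k n).repr a {i}) h1
  have hj := congrArg (fun a => (monBasis k n).repr a {j}) h1
  have h0 := congrArg (fun a => (monBasis k n).repr a 0) h1
  have hx0 : ∀ i : Fin n, (monBasis k n).repr (x k i) 0 = 0 := fun i => by
    rw [← mon_singleton, ← monBasis_apply, Module.Basis.repr_self, Finsupp.single_apply, if_neg]
    exact Multiset.singleton_ne_zero _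
  have h10 : (monBasis k n).repr (1 : WAlg k n) 0 = 1 := by
    rw [← mon_zero, ← monBasis_apply, Module.Basis.repr_self, Finsupp.single_eq_same]
  simp only [map_add, map_smul, Finsupp.add_apply, Finsupp.smul_apply, repr_one_singleton, repr_x,
    smul_eq_mul, map_zero, Finsupp.zero_apply, hx0, h10, if_neg hij, if_neg hij.symm, if_true,
    mul_zero, mul_one, add_zero, zero_add] at hi hj h0
  exact ⟨hj, hi, sub_eq_zero.1 h0⟩

/-- Affine combinations of the generators that satisfy the defining relations are monomial. -/
theorem exists_monomial_of_affine [IsDomain k] (h2 : (2 : k) ≠ 0) (hn : 2 ≤ n)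
    {g : Fin n → WAlg k n} (hg : ∀ i, g i ∈ filt k n 2) (hk : ∀ i c, g i ≠ algebraMap k _ c)
    (hanti : ∀ i j, i ≠ j → g i * g j + g j * g i = 1) :
    ∃ (σ : Equiv.Perm (Fin n)) (c : Fin n → k), (∀ i j, i ≠ j → c i * c j = 1) ∧
      ∀ i, g i = c (σ i) • x k (σ i) := by
  choose b a hab using fun i => mem_filt_two (hg i)
  -- The coefficient of `x_j ^ 2` in the anticommutator is `2 * a i j * a i' j` up to a unit, and it
  -- vanishes in `1`. Distinct rows of `a` thus have disjoint supports.
  have hdisj : ∀ i i', i ≠ i' → ∀ j, a i j = 0 ∨ a i' j = 0 := by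
    intro i i' hii j
    obtain ⟨ε, hε⟩ := repr_affine_mul_affine (k := k) j
    have h := congrArg (fun y => (monBasis k n).repr y {j, j}) (hanti i i' hii)
    have h1 : (monBasis k n).repr (1 : WAlg k n) {j, j} = 0 := by
      rw [← map_one (algebraMap k _)]
      exact repr_of_mem_filt (algebraMap_mem_filt 1) (by simp)
    simp only [hab i, hab i', map_add, Finsupp.add_apply] at h
    rw [hε, hε, h1] at h
    have h3 : 2 * (a i j * a i' j) * ε = 0 := by rw [← h]; ring
    simpa [h2] using h3
  have hne : ∀ i, ∃ j, a i j ≠ 0 := by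
    intro i
    by_contra! H
    exact hk i (b i) (by rw [hab i]; simp [H])
  choose f hf using hne
  -- Nonempty, pairwise disjoint supports in `n` columns form a permutation.
  have hinj : Function.Injective f := by
    intro i i' h
    by_contra hii
    rcases hdisj i i' hii (f i) with h0 | h0
    · exact hf i h0
    · exact hf i' (h ▸ h0)
  set σ : Equiv.Perm (Fin n) := Equiv.ofBijective f (Finite.injective_iff_bijective.1 hinj) with hσ
  have hσf : ∀ i, σ i = f i := fun i => rfl
  have hgi : ∀ i, g i = algebraMap k _ (b i) + a i (σ i) • x k (σ i) := by
    intro i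
    rw [hab i, Finset.sum_eq_single (σ i)]
    · intro j _ hj
      obtain ⟨i', rfl⟩ := σ.surjective j
      have hii : i ≠ i' := fun h => hj (by rw [h])
      rcases hdisj i i' hii (σ i') with h0 | h0
      · rw [h0, zero_smul]
      · exact absurd h0 (hf i')
    · intro h; exact absurd (Finset.mem_univ _) h
  have hrel : ∀ i i', i ≠ i' → _ := fun i i' hii =>
    affine_anticomm (σ.injective.ne hii) (by rw [← hgi i, ← hgi i']; exact hanti i i' hii)
  -- A second index `i'` exists since `n ≥ 2`; the coefficient of `x_{σ(i')}` gives `2 * b i * a i'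
  -- (σ i') = 0`.
  have hb : ∀ i, b i = 0 := by
    intro i
    have : Nontrivial (Fin n) := Fin.nontrivial_iff_two_le.2 hn
    obtain ⟨i', hii⟩ := exists_ne i
    simpa [h2, hσf, hf i'] using (hrel i i' hii.symm).1
  refine ⟨σ, fun j => a (σ.symm j) j, fun j j' hjj => ?_, fun i => ?_⟩
  · have := (hrel (σ.symm j) (σ.symm j') (σ.symm.injective.ne hjj)).2.2
    simpa [hb] using this
  · simp [hgi i, hb]

theorem swapTorus_eq (g : SwapTorus kˣ) :
    swapTorus k g = monomialHom g.right (fun i => ((torusWeight g.left i : kˣ) : k)) (by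
      intro i j h
      rw [← Units.val_mul, torusWeight_mul_eq_one _ h, Units.val_one]) := rfl

theorem signedPerm_eq (g : Equiv.Perm (Fin n) × ℤˣ) :
    signedPerm k n g = monomialHom g.1 (fun _ => ((g.2 : ℤ) : k)) (by
      intro i j _
      rw [← Int.cast_mul, Int.units_coe_mul_self, Int.cast_one]) := rfl

variable [IsDomain k]

theorem algEquiv_x (h2 : (2 : k) ≠ 0) (hn : 2 ≤ n) (hne : Even n)
    (ψ : WAlg k n ≃ₐ[k] WAlg k n) :
    ∃ (σ : Equiv.Perm (Fin n)) (c : Fin n → k), (∀ i j, i ≠ j → c i * c j = 1) ∧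
      ∀ i, ψ (x k i) = c (σ i) • x k (σ i) := by
  refine exists_monomial_of_affine h2 hn (g := fun i => ψ (x k i)) (fun i => ?_) (fun i c h => ?_)
    fun i j hij => by
      rw [← map_mul ψ, ← map_mul ψ, ← map_add ψ, x_mul_x k hij, map_one]
  -- Acting on coefficients extends `ψ` to `W_n[X]`, where the result for polynomial automorphisms
  -- applies.
  · obtain ⟨a, ha, h⟩ := map_C_x h2 hn hne (Polynomial.mapAlgEquiv ψ) i
    have h' : ψ (x k i) = a := C_injective (by rw [← h]; simp)
    rwa [h']
  · have hx : x k i = algebraMap k _ c := ψ.injective (h.trans (ψ.commutes c).symm)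
    have h1 := repr_x (k := k) i i
    rw [hx, repr_of_mem_filt (algebraMap_mem_filt c) (by simp), if_pos rfl] at h1
    exact zero_ne_one h1

theorem algEquiv_eq_monomialHom (h2 : (2 : k) ≠ 0) (hn : 2 ≤ n) (hne : Even n)
    (ψ : WAlg k n ≃ₐ[k] WAlg k n) :
    ∃ (σ : Equiv.Perm (Fin n)) (c : Fin n → k) (hc : ∀ i j, i ≠ j → c i * c j = 1),
      monomialHom σ c hc = ψ := by
  obtain ⟨σ, c, hc, h⟩ := algEquiv_x h2 hn hne ψ
  exact ⟨σ, c, hc, hom_ext fun i => by rw [monomialHom_x]; exact (h i).symm⟩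

theorem monomialHom_injective {σ τ : Equiv.Perm (Fin n)} {c d : Fin n → k}
    {hc : ∀ i j, i ≠ j → c i * c j = 1} {hd : ∀ i j, i ≠ j → d i * d j = 1} (hn : 2 ≤ n)
    (h : monomialHom σ c hc = monomialHom τ d hd) : σ = τ ∧ c = d := by
  have key : ∀ i, (if σ i = τ i then c (σ i) else 0) = d (τ i) := by
    intro i
    have h1 := congrArg (fun f : WAlg k n →ₐ[k] WAlg k n =>
      (monBasis k n).repr (f (x k i)) {τ i}) h
    simpa [repr_x] using h1
  have hd0 : ∀ i, d i ≠ 0 := by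
    intro i h0
    have : Nontrivial (Fin n) := Fin.nontrivial_iff_two_le.2 hn
    obtain ⟨j, hj⟩ := exists_ne i
    have := hd i j hj.symm
    rw [h0, zero_mul] at this
    exact zero_ne_one this
  have hστ : σ = τ := by
    ext i : 1
    by_contra hne
    have := key i
    rw [if_neg hne] at this
    exact hd0 _ this.symm
  refine ⟨hστ, ?_⟩
  subst hστ
  ext i
  simpa using key (σ.symm i)

theorem swapTorus_injective : Function.Injective (swapTorus k) := by
  intro p q h
  rw [swapTorus_eq, swapTorus_eq] at h
  obtain ⟨h1, h2⟩ := monomialHom_injective le_rfl h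
  refine SemidirectProduct.ext ?_ h1
  have := congrFun h2 0
  simp only [torusWeight, if_true] at this
  exact Units.ext this

theorem exists_swapTorus_eq (h2 : (2 : k) ≠ 0) (ψ : WAlg k 2 ≃ₐ[k] WAlg k 2) :
    ∃ g, swapTorus k g = ψ := by
  obtain ⟨σ, c, hc, h⟩ := algEquiv_eq_monomialHom h2 le_rfl even_two ψ
  have h01 : c 0 * c 1 = 1 := hc 0 1 (by decide)
  refine ⟨⟨⟨c 0, c 1, h01, by rw [mul_comm, h01]⟩, σ⟩, ?_⟩
  rw [← h]
  rw [swapTorus_eq]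
  congr 1
  ext i
  fin_cases i <;> simp [torusWeight]

theorem signedPerm_injective (h2 : (2 : k) ≠ 0) (hn : 2 ≤ n) :
    Function.Injective (signedPerm k n) := by
  intro p q h
  rw [signedPerm_eq, signedPerm_eq] at h
  obtain ⟨h1, h3⟩ := monomialHom_injective hn h
  refine Prod.ext h1 ?_
  have h4 := congrFun h3 ⟨0, by omega⟩
  have hneg : (-1 : k) ≠ 1 := fun h => h2 (by linear_combination -h)
  rcases Int.units_eq_one_or p.2 with hp | hp <;> rcases Int.units_eq_one_or q.2 with hq | hq <;>
    rw [hp, hq] at h4 ⊢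
  · simp at h4
    exact absurd h4.symm hneg
  · simp at h4
    exact absurd h4 hneg

/-- For any `i` and `j` there is a third index `l`, and `c i * c l = 1 = c j * c l` makes the
weights equal. Their common value squares to `1`, hence is a sign. -/
theorem exists_signedPerm_eq (h2 : (2 : k) ≠ 0) (hn : 4 ≤ n) (hne : Even n)
    (ψ : WAlg k n ≃ₐ[k] WAlg k n) : ∃ g, signedPerm k n g = ψ := by
  obtain ⟨σ, c, hc, h⟩ := algEquiv_eq_monomialHom h2 (by omega) hne ψ
  have hconst : ∀ i j, c i = c j := by
    intro i j
    obtain ⟨l, hl⟩ : ∃ l, l ∉ ({i, j} : Finset (Fin n)) := by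
      by_contra! H
      have h1 := Finset.card_le_card (fun l _ => H l : Finset.univ ⊆ ({i, j} : Finset (Fin n)))
      have h2 := Finset.card_le_two (a := i) (b := j)
      rw [Finset.card_univ, Fintype.card_fin] at h1
      omega
    simp only [Finset.mem_insert, Finset.mem_singleton, not_or] at hl
    have h1 := hc i l (Ne.symm hl.1)
    have h3 := hc j l (Ne.symm hl.2)
    have hl0 : c l ≠ 0 := right_ne_zero_of_mul_eq_one h1
    exact mul_right_cancel₀ hl0 (h1.trans h3.symm)
  set i₀ : Fin n := ⟨0, by omega⟩
  have hsq : c i₀ * c i₀ = 1 := by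
    have := hc i₀ ⟨1, by omega⟩ (by simp [i₀])
    rwa [hconst ⟨1, by omega⟩ i₀] at this
  rcases mul_self_eq_one_iff.1 hsq with h1 | h1
  · refine ⟨(σ, 1), ?_⟩
    rw [← h]
    rw [signedPerm_eq]
    congr 1
    ext i
    simp [hconst i i₀, h1]
  · refine ⟨(σ, -1), ?_⟩
    rw [← h]
    rw [signedPerm_eq]
    congr 1
    ext i
    simp [hconst i i₀, h1]

end Affine

/-! ### The automorphism group of `W_n[X]` -/

section Triangular

variable {k : Type*} [CommRing k] {n : ℕ} {G : Type*} [Group G]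
  (ρ : G →* (WAlg k n →ₐ[k] WAlg k n)) (hρ : ∀ g, ∀ a ∈ squares k n, ρ g a ∈ squares k n)

/-- The endomorphism of `W_n[X]` given by an element of the triangular group. -/
noncomputable def triMap (p : TriMat (k := k) (G := G) (M := squares k n) (restrictSquares ρ hρ)) :
    (WAlg k n)[X] →ₐ[k] (WAlg k n)[X] :=
  Polynomial.eval₂AlgHom (Polynomial.CAlgHom.comp (ρ p.diag))
    ((p.scal : k) • X + C (p.entry : WAlg k n))
    (fun _ => ((commute_X _).symm.smul_right _).add_right
      (commute_C_of_central (commute_of_mem_squares p.entry.2) _).symm)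

theorem triMap_C (p : TriMat (k := k) (G := G) (M := squares k n) (restrictSquares ρ hρ))
    (a : WAlg k n) : triMap ρ hρ p (C a) = C (ρ p.diag a) := by
  simp [triMap]

theorem triMap_X (p : TriMat (k := k) (G := G) (M := squares k n) (restrictSquares ρ hρ)) :
    triMap ρ hρ p X = (p.scal : k) • X + C (p.entry : WAlg k n) := by
  simp [triMap]

/-- The action of the triangular group on `W_n[X]`. -/
noncomputable def triHom : TriMat (k := k) (G := G) (M := squares k n) (restrictSquares ρ hρ) →*
    ((WAlg k n)[X] →ₐ[k] (WAlg k n)[X]) where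
  toFun := triMap ρ hρ
  map_one' := by
    apply Polynomial.algHom_ext'
    · refine AlgHom.ext fun a => ?_
      change triMap ρ hρ 1 (C a) = C a
      rw [triMap_C, TriMat.one_def, map_one, AlgHom.one_apply]
    · rw [triMap_X, TriMat.one_def]
      simp
  map_mul' p q := by
    apply Polynomial.algHom_ext'
    · refine AlgHom.ext fun a => ?_
      change triMap ρ hρ (p * q) (C a) = triMap ρ hρ p (triMap ρ hρ q (C a))
      rw [triMap_C, triMap_C, triMap_C, TriMat.mul_def, map_mul, AlgHom.mul_apply]
    · rw [AlgHom.mul_apply, triMap_X, triMap_X, map_add, map_smul, triMap_X, triMap_C,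
        TriMat.mul_def]
      change ((p.scal * q.scal : kˣ) : k) • X +
        C (ρ p.diag q.entry + (q.scal : k) • (p.entry : WAlg k n)) = _
      rw [Units.val_mul, mul_comm, smul_add, smul_smul, C_add, ← smul_C, add_assoc,
        add_comm (C _) (_ • C _)]

/-- Algebra automorphisms from a group of algebra endomorphisms. -/
noncomputable def autHom {H R B : Type*} [Group H] [CommSemiring R] [Semiring B] [Algebra R B]
    (f : H →* (B →ₐ[R] B)) : H →* (B ≃ₐ[R] B) :=
  (AlgEquiv.algHomUnitsEquiv R B).toMonoidHom.comp f.toHomUnits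

variable [IsDomain k]

/-- An automorphism of `W_n[X]` restricts to `W_n`. -/
theorem exists_restrict (h2 : (2 : k) ≠ 0) (hn : 2 ≤ n) (hne : Even n)
    (φ : (WAlg k n)[X] ≃ₐ[k] (WAlg k n)[X]) :
    ∃ ψ : WAlg k n ≃ₐ[k] WAlg k n, ∀ a, φ (C a) = C (ψ a) := by
  -- Stated for all automorphisms, since it is also applied to `φ.symm` to make the restriction
  -- invertible.
  have key : ∀ (φ : (WAlg k n)[X] ≃ₐ[k] (WAlg k n)[X]) (a : WAlg k n), ∃ b, φ (C a) = C b := by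
    intro φ a
    induction a using WAlg.induction with
    | algebraMap c => exact ⟨algebraMap k _ c, φ.commutes c⟩
    | x i =>
      obtain ⟨b, _, hb⟩ := map_C_x h2 hn hne φ i
      exact ⟨b, hb⟩
    | mul a b ha hb =>
      obtain ⟨a', ha⟩ := ha
      obtain ⟨b', hb⟩ := hb
      exact ⟨a' * b', by rw [C_mul, map_mul, ha, hb, C_mul]⟩
    | add a b ha hb =>
      obtain ⟨a', ha⟩ := ha
      obtain ⟨b', hb⟩ := hb
      exact ⟨a' + b', by rw [C_add, map_add, ha, hb, C_add]⟩
  choose f hf using key φ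
  choose f' hf' using key φ.symm
  refine ⟨{ toFun := f
            invFun := f'
            left_inv := fun a => C_injective (by rw [← hf', ← hf, φ.symm_apply_apply])
            right_inv := fun a => C_injective (by rw [← hf, ← hf', φ.apply_symm_apply])
            map_mul' := fun a b => C_injective (by rw [← hf, C_mul, map_mul, C_mul, hf, hf])
            map_add' := fun a b => C_injective (by rw [← hf, C_add, map_add, C_add, hf, hf])
            commutes' := fun c => C_injective (by rw [← hf]; exact φ.commutes c) }, hf⟩

/-- As `φ` preserves `W_n`, it is `ψ` on coefficients followed by substitution of `φ X`. Degrees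
multiply under substitution and `X` is in the image, so `φ X` has degree one. Its coefficients are
central because `X` is. -/
theorem exists_map_X (h2 : (2 : k) ≠ 0) (hne : Even n)
    (φ : (WAlg k n)[X] ≃ₐ[k] (WAlg k n)[X]) (ψ : WAlg k n ≃ₐ[k] WAlg k n)
    (h : ∀ a, φ (C a) = C (ψ a)) :
    ∃ (c : kˣ) (r : WAlg k n), r ∈ squares k n ∧ φ X = (c : k) • X + C r := by
  have hcomp : ∀ p, φ p = (p.map (ψ : WAlg k n →+* WAlg k n)).comp (φ X) := by
    intro p
    induction p using Polynomial.induction_on' with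
    | add p q hp hq => rw [map_add, hp, hq, Polynomial.map_add, add_comp]
    | monomial i a =>
      rw [map_monomial, ← C_mul_X_pow_eq_monomial, ← C_mul_X_pow_eq_monomial, map_mul φ, map_pow,
        h, C_mul_comp, X_pow_comp]
      rfl
  obtain ⟨p, hp⟩ := φ.surjective X
  have hdeg : (p.map (ψ : WAlg k n →+* WAlg k n)).natDegree * (φ X).natDegree = 1 := by
    rw [← natDegree_comp, ← hcomp, hp, natDegree_X]
  have hcentral : ∀ q, Commute (φ X) q := fun q => by
    have := (commute_X (φ.symm q)).map φ
    rwa [φ.apply_symm_apply] at this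
  have hX := eq_X_add_C_of_natDegree_le_one (Nat.eq_one_of_mul_eq_one_left hdeg).le
  set a₁ := (φ X).coeff 1
  set a₀ := (φ X).coeff 0
  have hc : ∀ i b, Commute ((φ X).coeff i) b := fun i b => by
    have := congrArg (fun q => q.coeff i) (hcentral (C b)).eq
    simp only [coeff_mul_C, coeff_C_mul] at this
    exact this
  obtain ⟨u, v, huv⟩ : ∃ u v, p.map (ψ : WAlg k n →+* WAlg k n) = C u * X + C v :=
    ⟨_, _, eq_X_add_C_of_natDegree_le_one (Nat.eq_one_of_mul_eq_one_right hdeg).le⟩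
  -- Coefficient of `X` in the substitution of `φ X` into `u X + v`, which yields `X`.
  have hu : u * a₁ = 1 := by
    have := congrArg (fun q => q.coeff 1) hp
    rw [hcomp p, huv] at this
    simpa [coeff_C_of_ne_zero, coeff_C_mul] using this
  have hunit : IsUnit a₁ := ⟨⟨a₁, u, by rw [(hc 1 u).eq]; exact hu, hu⟩, rfl⟩
  obtain ⟨c, hc1⟩ := eq_algebraMap_of_isUnit hunit
  refine ⟨c, a₀, mem_squares_of_central h2 hne (hc 0), ?_⟩
  rw [hX, hc1, Algebra.smul_def]
  rfl

/-- If `G` is the automorphism group of `W_n`, then the automorphism group of `W_n[X]` is the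
triangular group of `G`. -/
theorem exists_mulEquiv_polynomial (h2 : (2 : k) ≠ 0) (hn : 2 ≤ n) (hne : Even n)
    (hinj : Function.Injective ρ) (hsurj : ∀ ψ : WAlg k n ≃ₐ[k] WAlg k n, ∃ g, ρ g = ψ) :
    ∃ e : TriMat (k := k) (G := G) (M := squares k n) (restrictSquares ρ hρ) ≃*
        ((WAlg k n)[X] ≃ₐ[k] (WAlg k n)[X]),
      ∀ p, (∀ a, e p (C a) = C (ρ p.diag a)) ∧ e p X = (p.scal : k) • X + C (p.entry : WAlg k n) := by
  have hC : ∀ p a, autHom (triHom ρ hρ) p (C a) = C (ρ p.diag a) := triMap_C ρ hρ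
  have hX : ∀ p, autHom (triHom ρ hρ) p X = (p.scal : k) • X + C (p.entry : WAlg k n) :=
    triMap_X ρ hρ
  refine ⟨MulEquiv.ofBijective (autHom (triHom ρ hρ)) ⟨fun p q hpq => ?_, fun φ => ?_⟩,
    fun p => ⟨hC p, hX p⟩⟩
  -- The coefficients of the image of `X` recover `entry` and `scal`; the action on constants
  -- recovers `diag`.
  · have h1 := hX p
    rw [hpq, hX q] at h1
    have h3 := congrArg (fun q => q.coeff 0) h1
    have h4 := congrArg (fun q => q.coeff 1) h1
    simp only [coeff_add, coeff_smul, coeff_X_zero, coeff_X_one, coeff_C_zero, smul_zero, zero_add,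
      coeff_C_of_ne_zero one_ne_zero, add_zero, ← Algebra.algebraMap_eq_smul_one] at h3 h4
    refine TriMat.ext (hinj (AlgHom.ext fun a => C_injective ?_)) (Subtype.ext h3.symm)
      (Units.ext (algebraMap_injective k n h4.symm))
    rw [← hC, ← hC, hpq]
  · obtain ⟨ψ, hψ⟩ := exists_restrict h2 hn hne φ
    obtain ⟨c, r, hr, hφ⟩ := exists_map_X h2 hne φ ψ hψ
    obtain ⟨g, hg⟩ := hsurj ψ
    refine ⟨⟨g, ⟨r, hr⟩, c⟩, ?_⟩
    have : (autHom (triHom ρ hρ) ⟨g, ⟨r, hr⟩, c⟩ : (WAlg k n)[X] →ₐ[k] (WAlg k n)[X]) = φ := by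
      apply Polynomial.algHom_ext'
      · refine AlgHom.ext fun a => ?_
        change autHom (triHom ρ hρ) _ (C a) = φ (C a)
        rw [hC, hψ, hg]
        rfl
      · change autHom (triHom ρ hρ) _ X = φ X
        rw [hX, hφ]
    exact AlgEquiv.ext fun q => DFunLike.congr_fun this q

end Triangular

end WAlg

/-! ### Units of Laurent extensions -/

namespace Laurent

open WAlg

section Units

variable {A : Type*} [Ring A] {m : ℕ}

/-- Over a domain a uniquely represented exponent sum gives a nonzero coefficient of `a * b = 1`, so
that sum is zero. If some support had more than one element, there would be two different uniquely
represented pairs, both with sum zero, contradicting uniqueness. -/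
theorem exists_eq_single_of_mul_eq_one [NoZeroDivisors A] [Nontrivial A] {a b : Laurent A m}
    (h : a * b = 1) : ∃ v w c d, a = AddMonoidAlgebra.single v c ∧
      b = AddMonoidAlgebra.single w d ∧ c * d = 1 := by
  have ha : a.coeff.support.Nonempty := by
    rw [Finsupp.support_nonempty_iff, Ne, AddMonoidAlgebra.coeff_eq_zero]
    rintro rfl; simp at h
  have hb : b.coeff.support.Nonempty := by
    rw [Finsupp.support_nonempty_iff, Ne, AddMonoidAlgebra.coeff_eq_zero]
    rintro rfl; simp at h
  have hone : ∀ {v w : Fin m → ℤ}, UniqueAdd a.coeff.support b.coeff.support v w →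
      v ∈ a.coeff.support → w ∈ b.coeff.support → v + w = 0 := by
    intro v w huniq hv hw
    have h1 := AddMonoidAlgebra.coeff_mul_add_of_uniqueAdd huniq
    rw [h, AddMonoidAlgebra.one_def, AddMonoidAlgebra.coeff_single, Finsupp.single_apply] at h1
    by_contra hne
    rw [if_neg (Ne.symm hne)] at h1
    exact mul_ne_zero (Finsupp.mem_support_iff.1 hv) (Finsupp.mem_support_iff.1 hw) h1.symm
  have hcard : ¬ 1 < a.coeff.support.card * b.coeff.support.card := by
    intro hlt
    obtain ⟨p, hp, q, hq, hne, hpu, hqu⟩ := TwoUniqueSums.uniqueAdd_of_one_lt_card hlt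
    rw [Finset.mem_product] at hp hq
    have h1 := hone hpu hp.1 hp.2
    have h2 := hone hqu hq.1 hq.2
    have h3 := hqu hp.1 hp.2 (h1.trans h2.symm)
    exact hne (Prod.ext h3.1 h3.2)
  have ha1 := ha.card_pos
  have hb1 := hb.card_pos
  have hac : a.coeff.support.card = 1 := by
    by_contra hne
    exact hcard (Nat.one_lt_mul_iff.2 ⟨ha1, hb1, Or.inl (by omega)⟩)
  have hbc : b.coeff.support.card = 1 := by
    by_contra hne
    exact hcard (Nat.one_lt_mul_iff.2 ⟨ha1, hb1, Or.inr (by omega)⟩)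
  obtain ⟨v, c, -, hv⟩ := Finsupp.card_support_eq_one'.1 hac
  obtain ⟨w, d, -, hw⟩ := Finsupp.card_support_eq_one'.1 hbc
  have ha' : a = AddMonoidAlgebra.single v c := AddMonoidAlgebra.coeff_injective hv
  have hb' : b = AddMonoidAlgebra.single w d := AddMonoidAlgebra.coeff_injective hw
  refine ⟨v, w, c, d, ha', hb', ?_⟩
  rw [ha', hb', AddMonoidAlgebra.single_mul_single, AddMonoidAlgebra.one_def,
    AddMonoidAlgebra.single_inj] at h
  rcases h with h | h
  · exact h.2
  · exact absurd h.2 one_ne_zero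

end Units

variable {k : Type*} [CommRing k] {n m : ℕ}

theorem exists_eq_single_of_isUnit [IsDomain k] {a : Laurent (WAlg k n) m} (h : IsUnit a) :
    ∃ (v : Fin m → ℤ) (u : kˣ), a = AddMonoidAlgebra.single v (algebraMap k _ (u : k)) := by
  obtain ⟨⟨a, b, hab, hba⟩, rfl⟩ := h
  obtain ⟨v, w, c, d, rfl, rfl, hcd⟩ := exists_eq_single_of_mul_eq_one hab
  rw [AddMonoidAlgebra.single_mul_single, AddMonoidAlgebra.one_def,
    AddMonoidAlgebra.single_inj] at hba
  have hdc : d * c = 1 := by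
    rcases hba with h | h
    · exact h.2
    · exact absurd h.2 one_ne_zero
  obtain ⟨u, hu⟩ := eq_algebraMap_of_isUnit (a := c) ⟨⟨c, d, hcd, hdc⟩, rfl⟩
  exact ⟨v, u, by rw [← hu]⟩

/-! ### Base change of `W_n` to `k[t^±1]` -/

theorem coeffs_single (v : Fin m → ℤ) (c : k) : coeffs k (WAlg k n) m (AddMonoidAlgebra.single v c) =
    AddMonoidAlgebra.single v (algebraMap k _ c) := by
  simp [coeffs, Algebra.ofId_apply]

theorem commute_coeffs (l : Laurent k m) (b : Laurent (WAlg k n) m) :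
    Commute (coeffs k (WAlg k n) m l) b := by
  induction l using AddMonoidAlgebra.induction_linear with
  | zero => rw [map_zero]; exact Commute.zero_left _
  | add l l' h h' => rw [map_add]; exact h.add_left h'
  | single v c =>
    rw [coeffs_single]
    induction b using AddMonoidAlgebra.induction_linear with
    | zero => exact Commute.zero_right _
    | add l l' h h' => exact h.add_right h'
    | single w a =>
      change _ * _ = _ * _
      rw [AddMonoidAlgebra.single_mul_single, AddMonoidAlgebra.single_mul_single, add_comm,
        Algebra.commutes]

theorem single_eq_const_mul {A : Type*} [Ring A] (v : Fin m → ℤ) (a : A) :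
    (AddMonoidAlgebra.single v a : Laurent A m) = const m a * AddMonoidAlgebra.single v 1 := by
  rw [const, AddMonoidAlgebra.single_mul_single, zero_add, mul_one]

theorem ringHom_ext {B : Type*} [Ring B] {f g : Laurent (WAlg k n) m →+* B}
    (hl : ∀ l, f (coeffs k (WAlg k n) m l) = g (coeffs k (WAlg k n) m l))
    (hx : ∀ i, f (const m (x k i)) = g (const m (x k i))) : f = g := by
  have hconst : ∀ a : WAlg k n, f (const m a) = g (const m a) := by
    intro a
    induction a using WAlg.induction with
    | algebraMap c =>
      have := hl (AddMonoidAlgebra.single 0 c)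
      rwa [coeffs_single] at this
    | x i => exact hx i
    | mul a b ha hb =>
      have h : const m (a * b) = const m a * const m b := by
        rw [const, const, const, AddMonoidAlgebra.single_mul_single, add_zero]
      rw [h, map_mul, map_mul, ha, hb]
    | add a b ha hb =>
      have h : const m (a + b) = const m a + const m b := AddMonoidAlgebra.single_add _ _ _
      rw [h, map_add, map_add, ha, hb]
  refine RingHom.ext fun b => ?_
  induction b using AddMonoidAlgebra.induction_linear with
  | zero => rw [map_zero, map_zero]
  | add l l' h h' => rw [map_add, map_add, h, h']
  | single w a =>
    have := hl (AddMonoidAlgebra.single w 1)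
    rw [coeffs_single, map_one] at this
    rw [single_eq_const_mul, map_mul, map_mul, hconst, this]

noncomputable section

variable (k n m)

/-- `W_n[t_1^{±1}, …, t_m^{±1}]` as an algebra over `k[t_1^{±1}, …, t_m^{±1}]`. -/
abbrev coeffsAlgebra : Algebra (Laurent k m) (Laurent (WAlg k n) m) :=
  (coeffs k (WAlg k n) m).toRingHom.toAlgebra' commute_coeffs

/-- The map from `W_n` over `k[t_1^{±1}, …, t_m^{±1}]` to `W_n[t_1^{±1}, …, t_m^{±1}]`. -/
def ofW : WAlg (Laurent k m) n →+* Laurent (WAlg k n) m :=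
  letI := coeffsAlgebra k n m
  (RingQuot.liftAlgHom (Laurent k m) ⟨FreeAlgebra.lift (Laurent k m) fun i => const m (x k i), by
    rintro _ _ ⟨i, j, h⟩
    simp only [map_add, map_mul, map_one, FreeAlgebra.lift_ι_apply, const,
      AddMonoidAlgebra.single_mul_single, add_zero, ← AddMonoidAlgebra.single_add, x_mul_x k h]
    rfl⟩ : WAlg (Laurent k m) n →ₐ[Laurent k m] Laurent (WAlg k n) m).toRingHom

theorem ofW_x (i : Fin n) : ofW k n m (x (Laurent k m) i) = const m (x k i) := by
  let := coeffsAlgebra k n m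
  simp [ofW, x]

theorem ofW_algebraMap (l : Laurent k m) :
    ofW k n m (algebraMap _ _ l) = coeffs k (WAlg k n) m l := by
  let := coeffsAlgebra k n m
  exact AlgHom.commutes (RingQuot.liftAlgHom (Laurent k m) (s := WRel (Laurent k m) n) _) l

/-- The extension of scalars `W_n → W_n` from `k` to `k[t_1^{±1}, …, t_m^{±1}]`. -/
def baseChange : WAlg k n →ₐ[k] WAlg (Laurent k m) n :=
  RingQuot.liftAlgHom k ⟨FreeAlgebra.lift k fun i => x (Laurent k m) i, by
    rintro _ _ ⟨i, j, h⟩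
    simp only [map_add, map_mul, map_one, FreeAlgebra.lift_ι_apply]
    exact x_mul_x _ h⟩

theorem baseChange_x (i : Fin n) : baseChange k n m (x k i) = x (Laurent k m) i := by
  simp [baseChange, x]

/-- The map from `W_n[t_1^{±1}, …, t_m^{±1}]` to `W_n` over `k[t_1^{±1}, …, t_m^{±1}]`. -/
def toW : Laurent (WAlg k n) m →+* WAlg (Laurent k m) n :=
  AddMonoidAlgebra.liftNCRingHom (baseChange k n m).toRingHom
    (((algebraMap (Laurent k m) (WAlg (Laurent k m) n) : _ →+* _) : _ →* _).comp
      (AddMonoidAlgebra.of k (Fin m → ℤ)))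
    fun _ v => Algebra.commute_algebraMap_right
      (AddMonoidAlgebra.of k (Fin m → ℤ) v : Laurent k m) _

theorem toW_single (v : Fin m → ℤ) (a : WAlg k n) :
    toW k n m (AddMonoidAlgebra.single v a) =
      baseChange k n m a * algebraMap _ _ (AddMonoidAlgebra.single v (1 : k) : Laurent k m) := by
  simp [toW]

theorem toW_const_x (i : Fin n) : toW k n m (const m (x k i)) = x (Laurent k m) i := by
  rw [const, toW_single, baseChange_x, ← AddMonoidAlgebra.one_def, map_one, mul_one]

theorem toW_coeffs (l : Laurent k m) : toW k n m (coeffs k (WAlg k n) m l) = algebraMap _ _ l := by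
  induction l using AddMonoidAlgebra.induction_linear with
  | zero => rw [map_zero, map_zero, map_zero]
  | add l l' h h' => rw [map_add, map_add, map_add, h, h']
  | single v c =>
    rw [coeffs_single, toW_single, AlgHom.commutes,
      IsScalarTower.algebraMap_apply k (Laurent k m) (WAlg (Laurent k m) n), ← map_mul]
    congr 1
    change AddMonoidAlgebra.single 0 _ * AddMonoidAlgebra.single v 1 = _
    rw [AddMonoidAlgebra.single_mul_single]
    simp

/-- `W_n` over `k[t_1^{±1}, …, t_m^{±1}]` is `W_n[t_1^{±1}, …, t_m^{±1}]`. -/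
def equivW : WAlg (Laurent k m) n ≃+* Laurent (WAlg k n) m :=
  RingEquiv.ofRingHom (ofW k n m) (toW k n m)
    (ringHom_ext
      (fun l => by
        change ofW k n m (toW k n m _) = _
        rw [toW_coeffs, ofW_algebraMap]; rfl)
      fun i => by
        change ofW k n m (toW k n m _) = _
        rw [toW_const_x, ofW_x]; rfl)
    (by
      refine RingHom.ext fun a => ?_
      change toW k n m (ofW k n m a) = a
      induction a using WAlg.induction with
      | algebraMap l => rw [ofW_algebraMap, toW_coeffs]
      | x i => rw [ofW_x, toW_const_x]
      | mul a b ha hb => rw [map_mul, map_mul, ha, hb]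
      | add a b ha hb => rw [map_add, map_add, ha, hb])

theorem equivW_x (i : Fin n) : equivW k n m (x (Laurent k m) i) = const m (x k i) := ofW_x k n m i

theorem equivW_algebraMap (l : Laurent k m) :
    equivW k n m (algebraMap _ _ l) = coeffs k (WAlg k n) m l := ofW_algebraMap k n m l

theorem equivW_smul (l : Laurent k m) (a : WAlg (Laurent k m) n) :
    equivW k n m (l • a) = coeffs k (WAlg k n) m l * equivW k n m a := by
  rw [Algebra.smul_def, map_mul, equivW_algebraMap]

theorem equivW_symm_coeffs (l : Laurent k m) :
    (equivW k n m).symm (coeffs k (WAlg k n) m l) = algebraMap _ _ l := toW_coeffs k n m l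

theorem equivW_symm_const_x (i : Fin n) :
    (equivW k n m).symm (const m (x k i)) = x (Laurent k m) i := toW_const_x k n m i

end

end Laurent

/-! ### The automorphism group of the Laurent extension -/

namespace Laurent

open WAlg

variable {k : Type*} [CommRing k] {n m : ℕ}

theorem algHom_ext {B : Type*} [Ring B] [Algebra k B] {f g : Laurent (WAlg k n) m →ₐ[k] B}
    (hl : ∀ l, f (coeffs k (WAlg k n) m l) = g (coeffs k (WAlg k n) m l))
    (hx : ∀ i, f (const m (x k i)) = g (const m (x k i))) : f = g :=
  AlgHom.coe_ringHom_injective (ringHom_ext hl hx)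

noncomputable section

/-- The action of `(k^×)^m ⋊ GL_m(ℤ)` on `W_n[t_1^{±1}, …, t_m^{±1}]`. -/
def torusMap (n : ℕ) (g : TorusGL kˣ m) : Laurent (WAlg k n) m →ₐ[k] Laurent (WAlg k n) m :=
  AddMonoidAlgebra.liftNCAlgHom AddMonoidAlgebra.singleZeroAlgHom
    ((((coeffs k (WAlg k n) m).comp (torusGLHom k m g) : Laurent k m →ₐ[k] _) :
      Laurent k m →* Laurent (WAlg k n) m).comp (AddMonoidAlgebra.of k (Fin m → ℤ)))
    fun _ v => (commute_coeffs (torusGLHom k m g (AddMonoidAlgebra.of k (Fin m → ℤ) v)) _).symm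

theorem torusMap_single (g : TorusGL kˣ m) (v : Fin m → ℤ) (a : WAlg k n) :
    torusMap n g (AddMonoidAlgebra.single v a) =
      const m a * coeffs k (WAlg k n) m (torusGLHom k m g (AddMonoidAlgebra.single v 1)) := by
  change AddMonoidAlgebra.liftNC _ _ _ = _
  rw [AddMonoidAlgebra.liftNC_single]
  rfl

theorem torusMap_const (g : TorusGL kˣ m) (a : WAlg k n) :
    torusMap n g (const m a) = const m a := by
  rw [const, torusMap_single, ← AddMonoidAlgebra.one_def, map_one, map_one, mul_one, const]

theorem torusMap_coeffs (g : TorusGL kˣ m) (l : Laurent k m) :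
    torusMap n g (coeffs k (WAlg k n) m l) = coeffs k (WAlg k n) m (torusGLHom k m g l) := by
  induction l using AddMonoidAlgebra.induction_linear with
  | zero => simp only [map_zero]
  | add l l' h h' => simp only [map_add, h, h']
  | single v c =>
    rw [coeffs_single, torusMap_single]
    have h1 : const m (algebraMap k (WAlg k n) c) =
        coeffs k (WAlg k n) m (AddMonoidAlgebra.single 0 c) := by rw [coeffs_single]; rfl
    rw [h1, ← map_mul]
    congr 1
    rw [torusGLHom_single, torusGLHom_single, AddMonoidAlgebra.single_mul_single, zero_add, one_mul]

variable (n) in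
/-- The action of `(k^×)^m ⋊ GL_m(ℤ)` on `W_n[t_1^{±1}, …, t_m^{±1}]` as a homomorphism. -/
def torusHom : TorusGL kˣ m →* (Laurent (WAlg k n) m →ₐ[k] Laurent (WAlg k n) m) where
  toFun := torusMap n
  map_one' := algHom_ext (fun l => by rw [torusMap_coeffs, map_one]; rfl)
    fun i => by rw [torusMap_const]; rfl
  map_mul' g h := algHom_ext
    (fun l => by
      rw [AlgHom.mul_apply, torusMap_coeffs, torusMap_coeffs, torusMap_coeffs, map_mul,
        AlgHom.mul_apply])
    fun i => by rw [AlgHom.mul_apply, torusMap_const, torusMap_const, torusMap_const]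

variable {G : Type*} [Group G]

/-- Transport of an endomorphism of `W_n` over `k[t_1^{±1}, …, t_m^{±1}]`. -/
def transportMap (f : WAlg (Laurent k m) n →ₐ[Laurent k m] WAlg (Laurent k m) n) :
    Laurent (WAlg k n) m →ₐ[k] Laurent (WAlg k n) m :=
  { ((equivW k n m).toRingHom.comp f.toRingHom).comp (equivW k n m).symm.toRingHom with
    commutes' := fun c => by
      have h : algebraMap k (Laurent (WAlg k n) m) c =
          coeffs k (WAlg k n) m (algebraMap k (Laurent k m) c) := by
        rw [AlgHom.commutes]
      change equivW k n m (f ((equivW k n m).symm (algebraMap k _ c))) = _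
      rw [h, equivW_symm_coeffs, f.commutes, equivW_algebraMap] }

theorem transportMap_apply (f : WAlg (Laurent k m) n →ₐ[Laurent k m] WAlg (Laurent k m) n)
    (b : Laurent (WAlg k n) m) :
    transportMap f b = equivW k n m (f ((equivW k n m).symm b)) := rfl

theorem transportMap_coeffs (f : WAlg (Laurent k m) n →ₐ[Laurent k m] WAlg (Laurent k m) n)
    (l : Laurent k m) : transportMap f (coeffs k (WAlg k n) m l) = coeffs k (WAlg k n) m l := by
  rw [transportMap_apply, equivW_symm_coeffs, f.commutes, equivW_algebraMap]

theorem transportMap_const_x (f : WAlg (Laurent k m) n →ₐ[Laurent k m] WAlg (Laurent k m) n)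
    (i : Fin n) : transportMap f (const m (x k i)) = equivW k n m (f (x (Laurent k m) i)) := by
  rw [transportMap_apply, equivW_symm_const_x]

variable (ρ : G →* (WAlg (Laurent k m) n →ₐ[Laurent k m] WAlg (Laurent k m) n))

/-- Transport of a group action on `W_n` over `k[t_1^{±1}, …, t_m^{±1}]`. -/
def transportHom : G →* (Laurent (WAlg k n) m →ₐ[k] Laurent (WAlg k n) m) where
  toFun g := transportMap (ρ g)
  map_one' := algHom_ext (fun l => by rw [transportMap_coeffs]; rfl)
    fun i => by rw [transportMap_const_x, map_one, AlgHom.one_apply, equivW_x]; rfl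
  map_mul' g h := AlgHom.ext fun b => by
    rw [AlgHom.mul_apply, transportMap_apply, transportMap_apply, transportMap_apply,
      RingEquiv.symm_apply_apply, map_mul, AlgHom.mul_apply]

end

theorem monom_eq_of_hom {U : Type*} [CommGroup U] (u : (Fin m → ℤ) →+ Additive U)
    (v : Fin m → ℤ) : monom (fun i => (u (Pi.single i 1)).toMul) v = (u v).toMul := by
  have hv : v = ∑ i, v i • (Pi.single i 1 : Fin m → ℤ) := by
    ext j
    simp [Finset.sum_apply, Pi.single_apply]
  conv_rhs => rw [hv, map_sum]
  simp only [map_zsmul, monom]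
  rw [toMul_sum]
  rfl

/-- Fixing the central Laurent polynomials is, through `equivW`, linearity over `k[t^±1]`. -/
theorem exists_transport (ψ : Laurent (WAlg k n) m ≃ₐ[k] Laurent (WAlg k n) m)
    (hψ : ∀ l, ψ (coeffs k (WAlg k n) m l) = coeffs k (WAlg k n) m l) :
    ∃ f : WAlg (Laurent k m) n ≃ₐ[Laurent k m] WAlg (Laurent k m) n,
      ∀ b, transportMap (f : _ →ₐ[Laurent k m] _) b = ψ b := by
  refine ⟨AlgEquiv.ofRingEquiv (f := ((equivW k n m).trans (ψ : _ ≃+* _)).trans (equivW k n m).symm)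
    fun l => ?_, fun b => ?_⟩
  · change (equivW k n m).symm (ψ (equivW k n m _)) = _
    rw [equivW_algebraMap, hψ, equivW_symm_coeffs]
  · rw [transportMap_apply]
    change equivW k n m ((equivW k n m).symm (ψ (equivW k n m ((equivW k n m).symm b)))) = _
    rw [RingEquiv.apply_symm_apply, RingEquiv.apply_symm_apply]

variable [IsDomain k]

theorem single_unit_inj {v w : Fin m → ℤ} {c d : kˣ}
    (h : (AddMonoidAlgebra.single v (algebraMap k (WAlg k n) (c : k)) : Laurent (WAlg k n) m) =
      AddMonoidAlgebra.single w (algebraMap k (WAlg k n) (d : k))) : v = w ∧ c = d := by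
  rcases AddMonoidAlgebra.single_inj.1 h with h | h
  · exact ⟨h.1, Units.ext (algebraMap_injective k n h.2)⟩
  · have := algebraMap_injective k n (h.1.trans (map_zero _).symm)
    exact absurd this c.ne_zero

/-- The monomials `t^v` are units, so their images are monomials with unit coefficients.
Multiplicativity makes both exponent and coefficient additive in `v`. -/
theorem exists_map_single (φ : Laurent (WAlg k n) m ≃ₐ[k] Laurent (WAlg k n) m) :
    ∃ (N : (Fin m → ℤ) →+ (Fin m → ℤ)) (u : (Fin m → ℤ) →+ Additive kˣ),
      ∀ v, φ (AddMonoidAlgebra.single v 1) =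
        AddMonoidAlgebra.single (N v) (algebraMap k (WAlg k n) ((u v).toMul : kˣ)) := by
  have hunit : ∀ v : Fin m → ℤ, IsUnit (AddMonoidAlgebra.single v 1 : Laurent (WAlg k n) m) := by
    intro v
    refine ⟨⟨AddMonoidAlgebra.single v 1, AddMonoidAlgebra.single (-v) 1, ?_, ?_⟩, rfl⟩ <;>
      simp [AddMonoidAlgebra.single_mul_single, AddMonoidAlgebra.one_def]
  choose N u h using fun v => exists_eq_single_of_isUnit ((hunit v).map φ)
  have hadd : ∀ v w, N (v + w) = N v + N w ∧ u (v + w) = u v * u w := by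
    intro v w
    apply single_unit_inj (n := n)
    rw [← h, Units.val_mul, map_mul, ← AddMonoidAlgebra.single_mul_single, ← h, ← h, ← map_mul,
      AddMonoidAlgebra.single_mul_single, one_mul]
  refine ⟨AddMonoidHom.mk' N fun v w => (hadd v w).1,
    AddMonoidHom.mk' (fun v => Additive.ofMul (u v)) fun v w => ?_, h⟩
  rw [(hadd v w).2, ofMul_mul]

/-- Applied to an automorphism and its inverse in both orders, this makes the exponent map
invertible. -/
theorem map_single_comp {φ φ' : Laurent (WAlg k n) m ≃ₐ[k] Laurent (WAlg k n) m}
    (hφ : ∀ b, φ (φ' b) = b) {N N' : (Fin m → ℤ) →+ (Fin m → ℤ)}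
    {u u' : (Fin m → ℤ) →+ Additive kˣ}
    (h : ∀ v, φ (AddMonoidAlgebra.single v 1) =
        AddMonoidAlgebra.single (N v) (algebraMap k (WAlg k n) ((u v).toMul : kˣ)))
    (h' : ∀ v, φ' (AddMonoidAlgebra.single v 1) =
        AddMonoidAlgebra.single (N' v) (algebraMap k (WAlg k n) ((u' v).toMul : kˣ)))
    (v : Fin m → ℤ) : N (N' v) = v := by
  have h1 := hφ (AddMonoidAlgebra.single v 1)
  have h2 : (AddMonoidAlgebra.single (N' v) (algebraMap k (WAlg k n) ((u' v).toMul : kˣ)) :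
      Laurent (WAlg k n) m) = (((u' v).toMul : kˣ) : k) • AddMonoidAlgebra.single (N' v) 1 := by
    rw [AddMonoidAlgebra.smul_single, Algebra.algebraMap_eq_smul_one]
  rw [h', h2, map_smul, h, AddMonoidAlgebra.smul_single, Algebra.smul_def, ← map_mul,
    ← Units.val_mul] at h1
  exact (single_unit_inj (d := 1) (h1.trans (by simp))).1

theorem exists_torus (φ : Laurent (WAlg k n) m ≃ₐ[k] Laurent (WAlg k n) m) :
    ∃ g : TorusGL kˣ m, ∀ l, φ (coeffs k (WAlg k n) m l) = torusMap n g (coeffs k (WAlg k n) m l) := by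
  obtain ⟨N, u, h⟩ := exists_map_single φ
  obtain ⟨N', u', h'⟩ := exists_map_single φ.symm
  have hNN := map_single_comp φ.apply_symm_apply h h'
  have hNN' := map_single_comp φ.symm_apply_apply h' h
  set M := LinearMap.toMatrix' N.toIntLinearMap with hM
  set M' := LinearMap.toMatrix' N'.toIntLinearMap with hM'
  have hmul : M * M' = 1 := by
    rw [hM, hM', ← LinearMap.toMatrix'_comp]
    rw [show N.toIntLinearMap ∘ₗ N'.toIntLinearMap = LinearMap.id from LinearMap.ext hNN,
      LinearMap.toMatrix'_id]
  -- The torus acts after `M`, by `t^v ↦ c^(M v) t^(M v)`. Matching the coefficient `u v` requires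
  -- `c^(N v) = u v`, that is, `c` must be `u` composed with the inverse `N'` of `N`.
  let g : TorusGL kˣ m := ⟨fun i => (u (N' (Pi.single i 1))).toMul,
    ⟨M, M', hmul, mul_eq_one_comm.1 hmul⟩⟩
  refine ⟨g, fun l => ?_⟩
  have hMN : ∀ v, M.mulVec v = N v := fun v => by rw [hM, LinearMap.toMatrix'_mulVec]; rfl
  have hcomp : (φ : Laurent (WAlg k n) m →ₐ[k] _).comp (coeffs k (WAlg k n) m) =
      (torusMap n g).comp (coeffs k (WAlg k n) m) := by
    apply AddMonoidAlgebra.algHom_ext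
    · intro v
      change φ (coeffs k (WAlg k n) m _) = torusMap n g (coeffs k (WAlg k n) m _)
      rw [torusMap_coeffs, torusGLHom_single, coeffs_single, coeffs_single, map_one, h, one_mul]
      change _ = AddMonoidAlgebra.single (M.mulVec v)
        (algebraMap k (WAlg k n) (monom (fun i => (u (N' (Pi.single i 1))).toMul) (M.mulVec v) : kˣ))
      have hmon := monom_eq_of_hom (u.comp N') (N v)
      simp only [AddMonoidHom.comp_apply, hNN'] at hmon
      rw [hMN, hmon]
    · exact Subsingleton.elim _ _
  exact DFunLike.congr_fun hcomp l

/-- If `G` is the automorphism group of `W_n` over `k[t_1^{±1}, …, t_m^{±1}]`, then the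
automorphism group of `W_n[t_1^{±1}, …, t_m^{±1}]` is the semidirect product of `G` and
`(k^×)^m ⋊ GL_m(ℤ)`. -/
theorem exists_mulEquiv_laurent {G : Type*} [Group G]
    (ρ : G →* (WAlg (Laurent k m) n →ₐ[Laurent k m] WAlg (Laurent k m) n))
    (hinj : Function.Injective ρ)
    (hsurj : ∀ f : WAlg (Laurent k m) n ≃ₐ[Laurent k m] WAlg (Laurent k m) n, ∃ g, ρ g = f)
    (χ : TorusGL kˣ m →* MulAut G)
    (hχ : ∀ g h i, torusMap n g (equivW k n m (ρ h (x (Laurent k m) i))) =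
      equivW k n m (ρ (χ g h) (x (Laurent k m) i))) :
    ∃ e : (G ⋊[χ] TorusGL kˣ m) ≃* (Laurent (WAlg k n) m ≃ₐ[k] Laurent (WAlg k n) m),
      ∀ p, (∀ i, e p (const m (x k i)) = equivW k n m (ρ p.left (x (Laurent k m) i))) ∧
        ∀ j, e p (t (WAlg k n) j) = AddMonoidAlgebra.single (fun i => p.right.right.val i j)
          (algebraMap k (WAlg k n) ((∏ i, p.right.left i ^ p.right.right.val i j : kˣ) : k)) := by
  set F := autHom (transportHom ρ) with hF
  set T := autHom (torusHom (k := k) (m := m) n) with hT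
  -- This conjugation identity is what combines the two actions into one of the semidirect product;
  -- it suffices to check it on Laurent polynomials and generators.
  have hcompat : ∀ g, F.comp (χ g).toMonoidHom = (MulAut.conj (T g)).toMonoidHom.comp F := by
    intro g
    refine MonoidHom.ext fun h => ?_
    change F (χ g h) = T g * F h * (T g)⁻¹
    rw [eq_mul_inv_iff_mul_eq]
    refine AlgEquiv.ext fun b => DFunLike.congr_fun
      (f := (transportMap (ρ (χ g h))).comp (torusMap n g))
      (g := (torusMap n g).comp (transportMap (ρ h))) (algHom_ext (fun l => ?_) fun i => ?_) b
    · simp only [AlgHom.comp_apply, torusMap_coeffs, transportMap_coeffs]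
    · simp only [AlgHom.comp_apply, torusMap_const, transportMap_const_x, hχ]
  set E := SemidirectProduct.lift F T hcompat with hE
  have hEapp : ∀ p b, E p b = transportMap (ρ p.left) (torusMap n p.right b) := fun p b => rfl
  have hx : ∀ p i, E p (const m (x k i)) = equivW k n m (ρ p.left (x (Laurent k m) i)) := by
    intro p i
    rw [hEapp, torusMap_const, transportMap_const_x]
  have hl : ∀ p l, E p (coeffs k (WAlg k n) m l) =
      coeffs k (WAlg k n) m (torusGLHom k m p.right l) := by
    intro p l
    rw [hEapp, torusMap_coeffs, transportMap_coeffs]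
  have ht : ∀ p j, E p (t (WAlg k n) j) = AddMonoidAlgebra.single (fun i => p.right.right.val i j)
      (algebraMap k (WAlg k n) ((∏ i, p.right.left i ^ p.right.right.val i j : kˣ) : k)) := by
    intro p j
    have h1 : t (WAlg k n) j =
        coeffs k (WAlg k n) m (AddMonoidAlgebra.single (Pi.single j 1) 1) := by
      rw [coeffs_single, map_one, t]
    rw [h1, hl, torusGLHom_single, coeffs_single, Matrix.mulVec_single_one, one_mul]
    rfl
  refine ⟨MulEquiv.ofBijective E ⟨fun p q hpq => ?_, fun φ => ?_⟩, fun p => ⟨hx p, ht p⟩⟩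
  -- The image of `t_j` determines the `j`-th column of `M` and the product `c^M`; since `M` is
  -- invertible, `c` follows.
  · have hcol : ∀ j, (fun i => p.right.right.val i j) = (fun i => q.right.right.val i j) ∧
        (∏ i, p.right.left i ^ p.right.right.val i j) =
          ∏ i, q.right.left i ^ q.right.right.val i j := by
      intro j
      apply single_unit_inj (n := n)
      rw [← ht, ← ht, hpq]
    have hM : p.right.right = q.right.right := by
      ext i j
      exact congrFun (hcol j).1 i
    have hc : p.right.left = q.right.left := by
      have h1 : powMatrix p.right.left p.right.right.val =
          powMatrix q.right.left p.right.right.val := by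
        funext j
        have := (hcol j).2
        rw [← hM] at this
        exact this
      have h2 := congrArg (fun c => powMatrix c (p.right.right⁻¹).val) h1
      simpa only [← powMatrix_mul, ← Units.val_mul, mul_inv_cancel, Units.val_one,
        powMatrix_one] using h2
    refine SemidirectProduct.ext (hinj (WAlg.hom_ext fun i => (equivW k n m).injective ?_))
      (SemidirectProduct.ext hc hM)
    rw [← hx, ← hx, hpq]
  -- Dividing by the torus part of `φ` leaves an automorphism fixing `k[t^±1]`, which lies in the
  -- image of `G`.
  · obtain ⟨g, hg⟩ := exists_torus φ
    obtain ⟨f, hf⟩ := exists_transport (φ * (T g)⁻¹) (fun l => by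
      have h1 : (T g)⁻¹ (coeffs k (WAlg k n) m l) =
          coeffs k (WAlg k n) m (torusGLHom k m g⁻¹ l) := by
        rw [← map_inv]
        exact torusMap_coeffs g⁻¹ l
      rw [AlgEquiv.mul_apply, h1, hg, torusMap_coeffs, ← AlgHom.mul_apply, ← map_mul,
        mul_inv_cancel, map_one, AlgHom.one_apply])
    obtain ⟨h, hh⟩ := hsurj f
    refine ⟨⟨h, g⟩, ?_⟩
    have h1 : F h = φ * (T g)⁻¹ := AlgEquiv.ext fun b => by
      rw [← hf, ← hh]
      rfl
    change F h * T g = φ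
    rw [h1, inv_mul_cancel_right]

end Laurent

/-! ### Exponentials of locally nilpotent derivations -/

section ExpDerivation

variable {k A : Type*} [CommRing k] [Ring A] [Algebra k A] {D : A →ₗ[k] A}

theorem IsDerivation.pow_apply_mul (hD : IsDerivation D) (n : ℕ) (a b : A) :
    (D ^ n) (a * b) = ∑ ij ∈ Finset.HasAntidiagonal.antidiagonal n,
      n.choose ij.1 • ((D ^ ij.1) a * (D ^ ij.2) b) := by
  induction n with
  | zero => simp
  | succ n ih =>
    rw [Finset.sum_antidiagonal_choose_succ_nsmul (M := A) (fun i j => (D ^ i) a * (D ^ j) b) n]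
    simp only [pow_succ', Module.End.mul_apply, ih, map_sum, map_nsmul, hD _ _, smul_add,
      Finset.sum_add_distrib]
    rw [add_comm, add_right_inj]
    refine Finset.sum_congr rfl fun ⟨i, j⟩ hij => ?_
    rw [n.choose_symm_of_eq_add (Finset.HasAntidiagonal.mem_antidiagonal.1 hij).symm]

/-- The divided powers of a linear endomorphism. -/
noncomputable def dividedPow (f : ℚ →+* k) (D : A →ₗ[k] A) (n : ℕ) (a : A) : A :=
  f (n.factorial : ℚ)⁻¹ • (D ^ n) a

theorem dividedPow_zero (f : ℚ →+* k) (a : A) : dividedPow f D 0 a = a := by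
  simp [dividedPow]

theorem dividedPow_one (f : ℚ →+* k) (a : A) : dividedPow f D 1 a = D a := by
  simp [dividedPow]

theorem IsDerivation.dividedPow_mul (hD : IsDerivation D) (f : ℚ →+* k) (n : ℕ) (a b : A) :
    dividedPow f D n (a * b) = ∑ ij ∈ Finset.HasAntidiagonal.antidiagonal n,
      dividedPow f D ij.1 a * dividedPow f D ij.2 b := by
  rw [dividedPow, hD.pow_apply_mul, Finset.smul_sum]
  refine Finset.sum_congr rfl fun ⟨i, j⟩ hij => ?_
  rw [Finset.HasAntidiagonal.mem_antidiagonal] at hij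
  simp only at hij
  subst hij
  simp only [dividedPow]
  rw [smul_mul_smul_comm, ← map_mul, ← Nat.cast_smul_eq_nsmul k, smul_smul, ← map_natCast f,
    ← map_mul]
  congr 2
  have h1 : ((i + j).factorial : ℚ) ≠ 0 := by exact_mod_cast (i + j).factorial_ne_zero
  have h2 : (i.factorial : ℚ) ≠ 0 := by exact_mod_cast i.factorial_ne_zero
  have h3 : (j.factorial : ℚ) ≠ 0 := by exact_mod_cast j.factorial_ne_zero
  have h4 : ((i + j).choose i : ℚ) * i.factorial * j.factorial = (i + j).factorial := by
    rw [Nat.choose_symm_add]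
    exact_mod_cast Nat.add_choose_mul_factorial_mul_factorial i j
  field_simp
  linear_combination h4

theorem pow_apply_eq_zero_of_le {N i : ℕ} {a : A} (h : (D ^ N) a = 0) (hi : N ≤ i) :
    (D ^ i) a = 0 := by
  obtain ⟨j, rfl⟩ := Nat.exists_eq_add_of_le' hi
  rw [pow_add, Module.End.mul_apply, h, map_zero]

/-- The exponential `∑ X ^ i D ^ i / i!` of a locally nilpotent endomorphism. -/
noncomputable def expPoly (f : ℚ →+* k) (hN : IsLocallyNilpotent D) (a : A) : A[X] :=
  ∑ i ∈ Finset.range (hN a).choose, C (dividedPow f D i a) * X ^ i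

/-- Past the chosen bound the divided powers vanish, so the choice leaves no trace in the
coefficients. -/
theorem coeff_expPoly (f : ℚ →+* k) (hN : IsLocallyNilpotent D) (a : A) (i : ℕ) :
    (expPoly f hN a).coeff i = dividedPow f D i a := by
  rw [expPoly, finsetSum_coeff]
  simp only [coeff_C_mul_X_pow]
  rw [Finset.sum_ite_eq]
  split_ifs with h
  · rfl
  · rw [Finset.mem_range, not_lt] at h
    rw [dividedPow, pow_apply_eq_zero_of_le (hN a).choose_spec h, smul_zero]

theorem expPoly_eq_sum (f : ℚ →+* k) (hN : IsLocallyNilpotent D) {a : A} {N : ℕ}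
    (h : (D ^ N) a = 0) :
    expPoly f hN a = ∑ i ∈ Finset.range N, C (dividedPow f D i a) * X ^ i := by
  ext i
  rw [coeff_expPoly, finsetSum_coeff]
  simp only [coeff_C_mul_X_pow]
  rw [Finset.sum_ite_eq]
  split_ifs with hi
  · rfl
  · rw [Finset.mem_range, not_lt] at hi
    rw [dividedPow, pow_apply_eq_zero_of_le h hi, smul_zero]

theorem IsDerivation.map_one_eq_zero (hD : IsDerivation D) : D 1 = 0 := by
  have := hD 1 1
  simpa using this

theorem IsDerivation.map_algebraMap (hD : IsDerivation D) (c : k) : D (algebraMap k A c) = 0 := by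
  rw [Algebra.algebraMap_eq_smul_one, map_smul, hD.map_one_eq_zero, smul_zero]

/-- The exponential of a locally nilpotent derivation as an algebra homomorphism. -/
noncomputable def expAlgHom (f : ℚ →+* k) (hD : IsDerivation D) (hN : IsLocallyNilpotent D) :
    A →ₐ[k] A[X] where
  toFun := expPoly f hN
  map_zero' := by ext i; simp [coeff_expPoly, dividedPow]
  map_add' a b := by ext i; simp [coeff_expPoly, dividedPow]
  map_mul' a b := by
    ext i
    rw [coeff_mul, coeff_expPoly, hD.dividedPow_mul]
    simp only [coeff_expPoly]
  map_one' := by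
    rw [expPoly_eq_sum (N := 1) f hN (by simpa using hD.map_one_eq_zero)]
    simp [dividedPow_zero]
  commutes' c := by
    rw [expPoly_eq_sum (N := 1) f hN (by simpa using hD.map_algebraMap c)]
    simp [dividedPow_zero]

/-- The extension of the exponential of a locally nilpotent derivation to `A[X]`. -/
noncomputable def expPolyHom (f : ℚ →+* k) (hD : IsDerivation D) (hN : IsLocallyNilpotent D) :
    A[X] →ₐ[k] A[X] :=
  Polynomial.eval₂AlgHom (expAlgHom f hD hN) X fun _ => (commute_X _).symm

variable (f : ℚ →+* k) (hD : IsDerivation D) (hN : IsLocallyNilpotent D)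

theorem expPolyHom_C (a : A) : expPolyHom f hD hN (C a) = expPoly f hN a :=
  eval₂_C _ _

theorem expPolyHom_X : expPolyHom f hD hN X = X :=
  eval₂_X _ _

/-- Modulo `X` the exponential is the identity. -/
theorem coeff_zero_expPolyHom (p : A[X]) : (expPolyHom f hD hN p).coeff 0 = p.coeff 0 := by
  induction p using Polynomial.induction_on' with
  | add p q hp hq => rw [map_add, coeff_add, coeff_add, hp, hq]
  | monomial i a =>
    rw [← C_mul_X_pow_eq_monomial, map_mul, map_pow, expPolyHom_C, expPolyHom_X, mul_coeff_zero,
      mul_coeff_zero, coeff_expPoly, dividedPow_zero, coeff_C_zero]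

/-- An element of the kernel has zero constant term, hence is divisible by `X`. As `X` is fixed, the
quotient is again in the kernel, and the degree drops. -/
theorem expPolyHom_injective : Function.Injective (expPolyHom f hD hN) := by
  have key : ∀ (N : ℕ) (p : A[X]), p.natDegree ≤ N → expPolyHom f hD hN p = 0 → p = 0 := by
    intro N
    induction N with
    | zero =>
      intro p hp h
      have h0 := coeff_zero_expPolyHom f hD hN p
      rw [h, coeff_zero] at h0
      rw [eq_C_of_natDegree_le_zero hp, ← h0, C_0]
    | succ N ih =>
      intro p hp h
      have h0 := coeff_zero_expPolyHom f hD hN p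
      rw [h, coeff_zero] at h0
      have h1 : p.divX * X = p := by
        conv_rhs => rw [← divX_mul_X_add p, ← h0, C_0, add_zero]
      rw [← h1, map_mul, expPolyHom_X] at h
      rw [← h1, ih p.divX (by rw [natDegree_divX_eq_natDegree_tsub_one]; omega)
        (Polynomial.ext fun i => by rw [← coeff_mul_X, h, coeff_zero, coeff_zero]), zero_mul]
  exact (injective_iff_map_eq_zero _).2 fun p => key _ p le_rfl

/-- The constant `a` is its exponential minus terms `X^i D^i a / i!` with `i ≥ 1`, whose
coefficients are killed by a smaller power of `D`. Induction on that power puts all constants in the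
range, which also contains the powers of `X`. -/
theorem expPolyHom_surjective : Function.Surjective (expPolyHom f hD hN) := by
  have hX : ∀ i, X ^ i ∈ (expPolyHom f hD hN).range := fun i => ⟨X ^ i, by
    change expPolyHom f hD hN (X ^ i) = X ^ i
    rw [map_pow, expPolyHom_X]⟩
  have key : ∀ (N : ℕ) (a : A), (D ^ N) a = 0 → C a ∈ (expPolyHom f hD hN).range := by
    intro N
    induction N with
    | zero =>
      intro a ha
      have : a = 0 := by simpa using ha
      rw [this, C_0]
      exact Subalgebra.zero_mem _
    | succ N ih =>
      intro a ha
      have h := expPoly_eq_sum f hN ha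
      rw [Finset.sum_range_succ', dividedPow_zero, pow_zero, mul_one] at h
      rw [eq_sub_of_add_eq' h.symm]
      refine Subalgebra.sub_mem _ ⟨C a, expPolyHom_C f hD hN a⟩
        (Subalgebra.sum_mem _ fun i _ => Subalgebra.mul_mem _ (ih _ ?_) (hX _))
      rw [dividedPow, map_smul, ← Module.End.mul_apply, ← pow_add,
        pow_apply_eq_zero_of_le ha (by omega), smul_zero]
  intro p
  change p ∈ (expPolyHom f hD hN).range
  induction p using Polynomial.induction_on' with
  | add p q hp hq => exact Subalgebra.add_mem _ hp hq
  | monomial i a =>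
    obtain ⟨N, hNa⟩ := hN a
    rw [← C_mul_X_pow_eq_monomial]
    exact Subalgebra.mul_mem _ (key N a hNa) (hX i)

end ExpDerivation

namespace WAlg

/-- The automorphism `exp(X D)` maps `x_i` to a constant polynomial, whereas the coefficient of `X`
in that image is `D x_i`. A derivation vanishing on generators is zero. -/
theorem eq_zero_of_isLocallyNilpotent {k : Type*} [CommRing k] [IsDomain k] {n : ℕ}
    (h2 : (2 : k) ≠ 0) (hn : 2 ≤ n) (hne : Even n) (f : ℚ →+* k) {D : WAlg k n →ₗ[k] WAlg k n}
    (hD : IsDerivation D) (hN : IsLocallyNilpotent D) : D = 0 := by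
  have hx : ∀ i, D (x k i) = 0 := by
    intro i
    obtain ⟨a, _, ha⟩ := map_C_x h2 hn hne (AlgEquiv.ofBijective (expPolyHom f hD hN)
      ⟨expPolyHom_injective f hD hN, expPolyHom_surjective f hD hN⟩) i
    have h1 := congrArg (fun p => p.coeff 1) ((expPolyHom_C f hD hN (x k i)).symm.trans ha)
    simpa only [coeff_expPoly, dividedPow_one, coeff_C_of_ne_zero one_ne_zero] using h1
  ext a
  rw [LinearMap.zero_apply]
  induction a using WAlg.induction with
  | algebraMap c => exact hD.map_algebraMap c
  | x i => exact hx i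
  | mul a b ha hb => rw [hD, ha, hb, zero_mul, mul_zero, add_zero]
  | add a b ha hb => rw [map_add, ha, hb, add_zero]

end WAlg

/-! ### Compatibility of the actions and assembly of the theorem -/

namespace Laurent

open WAlg

theorem torusWeight_torusGLUnits {k : Type*} [CommRing k] {m : ℕ} (g : TorusGL kˣ m)
    (u : (Laurent k m)ˣ) (i : Fin 2) :
    torusWeight (torusGLUnits k m g u) i = torusGLUnits k m g (torusWeight u i) := by
  unfold torusWeight
  split_ifs
  · rfl
  · rw [map_inv]

theorem equivW_swapTorus {k : Type*} [CommRing k] {m : ℕ} (h : SwapTorus (Laurent k m)ˣ)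
    (i : Fin 2) :
    equivW k 2 m (swapTorus (Laurent k m) h (x (Laurent k m) i)) =
      coeffs k (WAlg k 2) m ((torusWeight h.left (h.right i) : (Laurent k m)ˣ) : Laurent k m) *
        const m (x k (h.right i)) := by
  rw [swapTorus_eq, monomialHom_x, equivW_smul, equivW_x]

theorem equivW_signedPerm {k : Type*} [CommRing k] {n m : ℕ} (h : Equiv.Perm (Fin n) × ℤˣ)
    (i : Fin n) :
    equivW k n m (signedPerm (Laurent k m) n h (x (Laurent k m) i)) =
      const m (((h.2 : ℤ) : k) • x k (h.1 i)) := by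
  rw [signedPerm_eq, monomialHom_x, equivW_smul, equivW_x, map_intCast, const, const,
    ← AddMonoidAlgebra.smul_single, Int.cast_smul_eq_zsmul, zsmul_eq_mul]

end Laurent

/-- Automorphisms are composed as maps, and each isomorphism is given by its values on generators;
the last clause concerns locally nilpotent derivations. -/
theorem theorem4p11 {k : Type*} [CommRing k] [IsDomain k] (h2 : IsUnit (2 : k))
    (n : ℕ) (hn : 0 < n) (hn_even : Even n) (m : ℕ) (hm : 0 < m) :
    (∃ e : TriSwapTorus k ≃* ((WAlg k 2)[X] ≃ₐ[k] (WAlg k 2)[X]),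
      ∀ p : TriSwapTorus k,
        (∀ i : Fin 2, e p (C (WAlg.x k i)) =
          C (((torusWeight p.diag.left (p.diag.right i) : kˣ) : k) •
            WAlg.x k (p.diag.right i))) ∧
        e p X = (p.scal : k) • X + C (p.entry : WAlg k 2)) ∧
    (∃ e : (SwapTorus (Laurent k m)ˣ ⋊[Laurent.torusGLSwap k m] Laurent.TorusGL kˣ m) ≃*
        (Laurent (WAlg k 2) m ≃ₐ[k] Laurent (WAlg k 2) m),
      ∀ p : SwapTorus (Laurent k m)ˣ ⋊[Laurent.torusGLSwap k m] Laurent.TorusGL kˣ m,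
        (∀ i : Fin 2, e p (Laurent.const m (WAlg.x k i)) =
          Laurent.coeffs k (WAlg k 2) m
              ((torusWeight p.left.left (p.left.right i) : (Laurent k m)ˣ) : Laurent k m) *
            Laurent.const m (WAlg.x k (p.left.right i))) ∧
        (∀ j : Fin m, e p (Laurent.t (WAlg k 2) j) =
          AddMonoidAlgebra.single (fun i => p.right.right.val i j)
            (algebraMap k (WAlg k 2)
              ((∏ i, p.right.left i ^ p.right.right.val i j : kˣ) : k)))) ∧
    (4 ≤ n →
      ∃ e : TriSignedPerm k n ≃* ((WAlg k n)[X] ≃ₐ[k] (WAlg k n)[X]),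
        ∀ p : TriSignedPerm k n,
          (∀ i : Fin n, e p (C (WAlg.x k i)) =
            C (((p.diag.2 : ℤ) : k) • WAlg.x k (p.diag.1 i))) ∧
          e p X = (p.scal : k) • X + C (p.entry : WAlg k n)) ∧
    (4 ≤ n →
      ∃ e : ((Equiv.Perm (Fin n) × ℤˣ) × Laurent.TorusGL kˣ m) ≃*
          (Laurent (WAlg k n) m ≃ₐ[k] Laurent (WAlg k n) m),
        ∀ p : (Equiv.Perm (Fin n) × ℤˣ) × Laurent.TorusGL kˣ m,
          (∀ i : Fin n, e p (Laurent.const m (WAlg.x k i)) =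
            Laurent.const m (((p.1.2 : ℤ) : k) • WAlg.x k (p.1.1 i))) ∧
          (∀ j : Fin m, e p (Laurent.t (WAlg k n) j) =
            AddMonoidAlgebra.single (fun i => p.2.right.val i j)
              (algebraMap k (WAlg k n)
                ((∏ i, p.2.left i ^ p.2.right.val i j : kˣ) : k)))) ∧
    (Nonempty (ℚ →+* k) →
      ∀ D : WAlg k n →ₗ[k] WAlg k n, IsDerivation D → IsLocallyNilpotent D → D = 0) := by
  have h20 : (2 : k) ≠ 0 := h2.ne_zero
  have hn2 : 2 ≤ n := by
    obtain ⟨c, rfl⟩ := hn_even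
    omega
  have hL : (2 : Laurent k m) ≠ 0 := by
    intro h
    have h0 := (h2.map (algebraMap k (Laurent k m))).ne_zero
    rw [map_ofNat] at h0
    exact h0 h
  refine ⟨?_, ?_, fun hn4 => ?_, fun hn4 => ?_, ?_⟩
  · obtain ⟨e, he⟩ := WAlg.exists_mulEquiv_polynomial (WAlg.swapTorus k)
      (fun _ _ ha => WAlg.monomialHom_mem_squares _ _ _ _ ha) h20 le_rfl even_two
      WAlg.swapTorus_injective (WAlg.exists_swapTorus_eq h20)
    refine ⟨e, fun p => ⟨fun i => ((he p).1 _).trans ?_, (he p).2⟩⟩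
    rw [WAlg.swapTorus_eq, WAlg.monomialHom_x]
  -- The description of automorphisms of `W_2` is used over the base `k[t^±1]`, so the torus
  -- parameter ranges over Laurent units, on which the second factor acts.
  · obtain ⟨e, he⟩ := Laurent.exists_mulEquiv_laurent (WAlg.swapTorus (Laurent k m))
      WAlg.swapTorus_injective (WAlg.exists_swapTorus_eq hL) (Laurent.torusGLSwap k m)
      (fun g h i => by
        rw [Laurent.equivW_swapTorus, Laurent.equivW_swapTorus, map_mul, Laurent.torusMap_coeffs,
          Laurent.torusMap_const]
        change _ = Laurent.coeffs k (WAlg k 2) m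
          ((torusWeight (Laurent.torusGLUnits k m g h.left) (h.right i) : (Laurent k m)ˣ) :
            Laurent k m) * _
        rw [Laurent.torusWeight_torusGLUnits]
        rfl)
    refine ⟨e, fun p => ⟨fun i => ?_, (he p).2⟩⟩
    rw [(he p).1, Laurent.equivW_swapTorus]
  · obtain ⟨e, he⟩ := WAlg.exists_mulEquiv_polynomial (WAlg.signedPerm k n)
      (fun _ _ ha => WAlg.monomialHom_mem_squares _ _ _ _ ha) h20 hn2 hn_even
      (WAlg.signedPerm_injective h20 hn2) (WAlg.exists_signedPerm_eq h20 hn4 hn_even)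
    refine ⟨e, fun p => ⟨fun i => ((he p).1 _).trans ?_, (he p).2⟩⟩
    rw [WAlg.signedPerm_eq, WAlg.monomialHom_x]
  -- Signs are integers and hence fixed by the torus action, so the action on `S_n × {±1}` is
  -- trivial and the semidirect product is direct.
  · obtain ⟨e, he⟩ := Laurent.exists_mulEquiv_laurent (WAlg.signedPerm (Laurent k m) n)
      (WAlg.signedPerm_injective hL hn2) (WAlg.exists_signedPerm_eq hL hn4 hn_even) 1
      (fun g h i => by
        rw [MonoidHom.one_apply, MulAut.one_apply, Laurent.equivW_signedPerm,
          Laurent.torusMap_const])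
    refine ⟨SemidirectProduct.mulEquivProd.symm.trans e, fun p => ⟨fun i => ?_, fun j => ?_⟩⟩
    · rw [MulEquiv.trans_apply, (he _).1, Laurent.equivW_signedPerm]
      rfl
    · rw [MulEquiv.trans_apply, (he _).2]
      rfl
  · rintro ⟨f⟩ D hD hN
    exact WAlg.eq_zero_of_isLocallyNilpotent h20 hn2 hn_even f hD hN
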